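/- Let $K$ be a field of characteristic $0$ and $t\in K$ (for example $K=\mathbb Q(q,t)$ with $t$ an indeterminate). Let $\Lambda$ be the ring of symmetric functions in infinitely many variables $X=x_1+x_2+\cdots$ with coefficients in $K$, with the scalar product $\langle p_\lambda,p_\mu\rangle=\delta_{\lambda\mu}z_\lambda$, $z_\lambda=\prod_n n^{m_n(\lambda)}m_n(\lambda)!$, where $p_\lambda$ are the power sum products and $m_n(\lambda)$ is the number of parts of $\lambda$ equal to $n$. For $f\in\Lambda$ let $f^\perp$ be the adjoint of multiplication by $f$, let $s_i=h_i$ be the complete homogeneous symmetric function ($h_i=0$ for $i<0$), and let $f\mapsto f[X(t-1)]$ be the $K$-algebra endomorphism of $\Lambda$ with $p_n\mapsto(t^n-1)p_n$. For $m\in\mathbb Z$ define the operator on $\Lambda$ $$B_m=\sum_{i\ge0}s_{i+m}[X]\,s_i[X(t-1)]^\perp ,$$ and for $v\in\mathbb Z^L$ $$B_v=\prod_{1\le i<j\le L}(1-te_{ij})\,B_{v_1}\cdots B_{v_L},$$ where $e_{ij}$ acts formally on index vectors, raising the $i$-th index by $1$ and lowering the $j$-th index by $1$. For a partition $\nu$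 with nonzero parts $\nu_1\ge\dots\ge\nu_r$, $B_\nu$ is the operator $B_{(\nu_1,\dots,\nu_r)}$; $(\ell^{k+1-\ell})$ is the vector with $k+1-\ell$ entries equal to $\ell$. (a) For all nonnegative integers $k,\ell,i$ with $\ell\le i\le k$, $$B_{\ell^{k+1-\ell}}\,B_i=t^{\,i-\ell}\,B_i\,B_{\ell^{k+1-\ell}}.$$ (b) Let $k,\ell$ be nonnegative integers and let $\nu$ be a nonempty partition with exactly $r$ nonzero parts, whose main hook-length (the hook-length $\nu_1+r-1$ of the corner cell $(1,1)$) equals $k$, and with $\nu_r\ge\ell$. Then $$B_{\ell^{k+1-\ell}}\,B_\nu=t^{\,|\nu|-r\ell}\,B_\nu\,B_{\ell^{k+1-\ell}}.$$ -/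

import Mathlib

open MvPowerSeries in
/-- The ring `Λ` of symmetric functions in the variables `x₀, x₁, x₂, …` over `K`: formal power
series of bounded degree that are invariant under all permutations of the variables. -/
def SymFun (K : Type*) [Field K] : Subalgebra K (MvPowerSeries ℕ K) where
  carrier := {f | (∀ e : Equiv.Perm ℕ, renameEquiv K e f = f) ∧
    ∃ N : ℕ, ∀ d : ℕ →₀ ℕ, N < d.degree → coeff d f = 0}
  mul_mem' := by
    rintro f g ⟨hf, M, hM⟩ ⟨hg, N, hN⟩
    refine ⟨fun e => by rw [map_mul, hf, hg], M + N, fun d hd => ?_⟩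
    rw [coeff_mul]
    refine Finset.sum_eq_zero fun x hx => ?_
    have hx' : x.1.degree + x.2.degree = d.degree := by
      rw [← Finset.HasAntidiagonal.mem_antidiagonal.mp hx, map_add]
    rcases lt_or_ge M x.1.degree with h | h
    · rw [hM _ h, zero_mul]
    · rw [hN _ (by omega), mul_zero]
  add_mem' := by
    rintro f g ⟨hf, M, hM⟩ ⟨hg, N, hN⟩
    refine ⟨fun e => by rw [map_add, hf, hg], max M N, fun d hd => ?_⟩
    rw [map_add, hM _ (lt_of_le_of_lt (le_max_left _ _) hd),
      hN _ (lt_of_le_of_lt (le_max_right _ _) hd), add_zero]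
  algebraMap_mem' := by
    intro r
    refine ⟨fun e => AlgEquiv.commutes _ _, 0, fun d hd => ?_⟩
    rw [MvPowerSeries.algebraMap_apply, coeff_C, if_neg]
    rintro rfl
    simp at hd

namespace SymFun

variable {K : Type*} [Field K]

theorem coeff_mapDomain_rename (e : Equiv.Perm ℕ) (f : MvPowerSeries ℕ K) (d : ℕ →₀ ℕ) :
    MvPowerSeries.coeff (d.mapDomain e) (MvPowerSeries.renameEquiv K e f) =
      MvPowerSeries.coeff d f := by
  have := MvPowerSeries.coeff_embDomain_rename e.toEmbedding f d
  rw [Finsupp.embDomain_eq_mapDomain] at this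
  exact this

theorem coeff_mapDomain {f : MvPowerSeries ℕ K} (hf : f ∈ SymFun K) (e : Equiv.Perm ℕ)
    (d : ℕ →₀ ℕ) : MvPowerSeries.coeff (d.mapDomain e) f = MvPowerSeries.coeff d f := by
  conv_lhs => rw [← hf.1 e]
  exact coeff_mapDomain_rename e f d

theorem mem_of_coeff {f : MvPowerSeries ℕ K}
    (hf : ∀ (e : Equiv.Perm ℕ) (d : ℕ →₀ ℕ),
      MvPowerSeries.coeff (d.mapDomain e) f = MvPowerSeries.coeff d f)
    (N : ℕ) (hN : ∀ d : ℕ →₀ ℕ, N < d.degree → MvPowerSeries.coeff d f = 0) : f ∈ SymFun K := by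
  refine ⟨fun e => ?_, N, hN⟩
  ext d
  have hd : (d.mapDomain e.symm).mapDomain e = d := by
    rw [← Finsupp.mapDomain_comp]; simp
  rw [← hd, coeff_mapDomain_rename, hf e]

open Classical in
/-- The power sum `∑ⱼ xⱼⁿ` as a power series. -/
noncomputable def psumSeries (K : Type*) [Field K] (n : ℕ+) : MvPowerSeries ℕ K :=
  fun d => if ∃ j, d = Finsupp.single j (n : ℕ) then 1 else 0

open Classical in
theorem coeff_psumSeries (n : ℕ+) (d : ℕ →₀ ℕ) :
    MvPowerSeries.coeff d (psumSeries K n) =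
      if ∃ j, d = Finsupp.single j (n : ℕ) then 1 else 0 := rfl

theorem psumSeries_mem (n : ℕ+) : psumSeries K n ∈ SymFun K := by
  classical
  refine mem_of_coeff (fun e d => ?_) n (fun d hd => ?_)
  · rw [coeff_psumSeries, coeff_psumSeries]
    congr 1
    refine propext ⟨?_, ?_⟩
    · rintro ⟨j, hj⟩
      refine ⟨e.symm j, Finsupp.mapDomain_injective e.injective ?_⟩
      rw [hj, Finsupp.mapDomain_single, Equiv.apply_symm_apply]
    · rintro ⟨j, rfl⟩
      exact ⟨e j, Finsupp.mapDomain_single⟩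
  · rw [coeff_psumSeries, if_neg]
    rintro ⟨j, rfl⟩
    simp at hd

/-- The power sum symmetric function `pₙ`, `n ≥ 1`. -/
noncomputable def psum (K : Type*) [Field K] (n : ℕ+) : SymFun K :=
  ⟨psumSeries K n, psumSeries_mem n⟩

/-- The complete homogeneous symmetric function `hᵣ`, the sum of all monomials of degree `r`;
it is `0` for `r < 0`. It is also the Schur function `sᵣ` of a single row. -/
noncomputable def hsymm (K : Type*) [Field K] (r : ℤ) : SymFun K :=
  ⟨fun d => if (d.degree : ℤ) = r then 1 else 0, by
    refine mem_of_coeff (fun e d => ?_) r.toNat (fun d hd => ?_)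
    · change (if ((d.mapDomain e).degree : ℤ) = r then (1 : K) else 0) =
        if (d.degree : ℤ) = r then 1 else 0
      rw [Finsupp.degree_mapDomain]
    · change (if (d.degree : ℤ) = r then (1 : K) else 0) = 0
      rw [if_neg]
      omega⟩

theorem coeff_hsymm (r : ℤ) (d : ℕ →₀ ℕ) :
    MvPowerSeries.coeff d (hsymm K r : MvPowerSeries ℕ K) =
      if (d.degree : ℤ) = r then 1 else 0 := rfl

/-! ### The power sums generate `Λ` freely -/

/-- Substitution of the power sums for the variables of a polynomial ring. -/
noncomputable def ofPoly (K : Type*) [Field K] : MvPolynomial ℕ+ K →ₐ[K] SymFun K :=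
  MvPolynomial.aeval (psum K)

/-- The product of power sums with multiplicities `a`, as a power series. -/
noncomputable def pmon (K : Type*) [Field K] (a : ℕ+ →₀ ℕ) : MvPowerSeries ℕ K :=
  a.prod fun n m => psumSeries K n ^ m

theorem coe_ofPoly_monomial (a : ℕ+ →₀ ℕ) (c : K) :
    (ofPoly K (MvPolynomial.monomial a c) : MvPowerSeries ℕ K) = c • pmon K a := by
  rw [ofPoly, MvPolynomial.aeval_monomial, ← Algebra.smul_def]
  simp [pmon, Finsupp.prod, psum]

theorem pmon_add (a b : ℕ+ →₀ ℕ) : pmon K (a + b) = pmon K a * pmon K b :=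
  Finsupp.prod_add_index' (fun _ => pow_zero _) (fun _ _ _ => pow_add _ _ _)

theorem pmon_single (n : ℕ+) : pmon K (Finsupp.single n 1) = psumSeries K n := by
  simp [pmon]

theorem pmon_zero : pmon K 0 = 1 := by simp [pmon]

theorem coeff_psumSeries_mul (n : ℕ+) (F : MvPowerSeries ℕ K) (d : ℕ →₀ ℕ) :
    MvPowerSeries.coeff d (F * psumSeries K n) =
      ∑ j ∈ d.support with (n : ℕ) ≤ d j,
        MvPowerSeries.coeff (d - Finsupp.single j (n : ℕ)) F := by
  classical
  rw [MvPowerSeries.coeff_mul]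
  simp_rw [coeff_psumSeries, mul_ite, mul_one, mul_zero]
  rw [← Finset.sum_filter]
  symm
  refine Finset.sum_bij (fun j _ => (d - Finsupp.single j (n : ℕ), Finsupp.single j (n : ℕ)))
    ?_ ?_ ?_ ?_
  · intro j hj
    rw [Finset.mem_filter] at hj
    refine Finset.mem_filter.mpr ⟨Finset.HasAntidiagonal.mem_antidiagonal.mpr ?_, j, rfl⟩
    exact tsub_add_cancel_of_le (Finsupp.single_le_iff.mpr hj.2)
  · intro i _ j _ h
    exact Finsupp.single_left_injective n.pos.ne' (Prod.ext_iff.mp h).2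
  · rintro ⟨u, v⟩ h
    obtain ⟨h1, j, hj⟩ := Finset.mem_filter.mp h
    have h1 := Finset.HasAntidiagonal.mem_antidiagonal.mp h1
    simp only at h1 hj
    subst hj
    have hle : (n : ℕ) ≤ d j := by rw [← h1]; simp
    refine ⟨j, Finset.mem_filter.mpr ⟨?_, hle⟩, ?_⟩
    · rw [Finsupp.mem_support_iff]
      have := n.pos
      omega
    · rw [← h1]; simp
  · intro j _
    rfl

/-- The multiset of nonzero exponents of a monomial, as a multiplicity function. -/
noncomputable def expType (d : ℕ →₀ ℕ) : ℕ+ →₀ ℕ :=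
  ∑ j ∈ d.support, Finsupp.single (d j).toPNat' 1

theorem degree_expType (d : ℕ →₀ ℕ) : (expType d).degree = d.support.card := by
  simp [expType, map_sum]

theorem expType_apply (d : ℕ →₀ ℕ) (n : ℕ+) :
    expType d n = (d.support.filter fun j => d j = n).card := by
  classical
  rw [expType, Finsupp.finsetSum_apply, Finset.card_filter]
  refine Finset.sum_congr rfl fun j hj => ?_
  have hj : 0 < d j := Nat.pos_of_ne_zero (Finsupp.mem_support_iff.mp hj)
  rw [Finsupp.single_apply]
  congr 1
  rw [← PNat.coe_inj, Nat.toPNat'_coe, if_pos hj]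

theorem expType_add_single (d : ℕ →₀ ℕ) (j : ℕ) (hj : d j = 0) (n : ℕ+) :
    expType (d + Finsupp.single j (n : ℕ)) = expType d + Finsupp.single n 1 := by
  classical
  have hn := n.pos
  have hs : (d + Finsupp.single j (n : ℕ)).support = insert j d.support := by
    ext i
    by_cases h : i = j
    · subst h; simp
    · simp [h]
  have hj' : j ∉ d.support := by simpa using hj
  rw [expType, hs, Finset.sum_insert hj', add_comm, expType]
  congr 1
  · refine Finset.sum_congr rfl fun i hi => ?_
    have : j ≠ i := fun h => hj' (h ▸ hi)
    simp [this]
  · simp [hj]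

theorem finsupp_induction {motive : (ℕ+ →₀ ℕ) → Prop} (a : ℕ+ →₀ ℕ) (zero : motive 0)
    (add_single : ∀ n a, motive a → motive (a + Finsupp.single n 1)) : motive a := by
  induction a using Finsupp.induction₂ with
  | zero => exact zero
  | add_single n m a _ _ ih =>
    clear * - ih add_single
    induction m with
    | zero => simpa using ih
    | succ m ihm =>
      rw [Finsupp.single_add, ← add_assoc]
      exact add_single _ _ ihm

theorem exists_expType (a : ℕ+ →₀ ℕ) : ∃ d, expType d = a := by
  induction a using finsupp_induction with
  | zero => exact ⟨0, by simp [expType]⟩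
  | add_single n a ih =>
    obtain ⟨d, rfl⟩ := ih
    obtain ⟨j, hj⟩ := Infinite.exists_notMem_finset d.support
    exact ⟨d + Finsupp.single j (n : ℕ), expType_add_single d j (by simpa using hj) n⟩

theorem expType_sub_single {d : ℕ →₀ ℕ} {j : ℕ} {n : ℕ+} (h : d j = n) :
    expType (d - Finsupp.single j (n : ℕ)) + Finsupp.single n 1 = expType d := by
  have h0 : (d - Finsupp.single j (n : ℕ)) j = 0 := by
    rw [Finsupp.tsub_apply, Finsupp.single_eq_same, h, Nat.sub_self]
  rw [← expType_add_single _ j h0 n, tsub_add_cancel_of_le (Finsupp.single_le_iff.mpr h.ge)]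

theorem card_support_sub_single {d : ℕ →₀ ℕ} {j : ℕ} {n : ℕ} (h : n < d j) :
    (d - Finsupp.single j n).support = d.support := by
  classical
  ext i
  by_cases hi : j = i
  · subst hi
    simp only [Finsupp.mem_support_iff, Finsupp.tsub_apply, Finsupp.single_eq_same]
    omega
  · simp [hi]

open Classical in
theorem exists_coeff_pmon [CharZero K] (a : ℕ+ →₀ ℕ) :
    ∃ c : K, c ≠ 0 ∧ ∀ d : ℕ →₀ ℕ, a.degree ≤ d.support.card →
      MvPowerSeries.coeff d (pmon K a) = if expType d = a then c else 0 := by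
  induction a using finsupp_induction with
  | zero =>
    refine ⟨1, one_ne_zero, fun d _ => ?_⟩
    rw [pmon_zero, MvPowerSeries.coeff_one]
    congr 1
    refine propext ⟨fun h => by simp [h, expType], fun h => ?_⟩
    have := degree_expType d
    rw [h] at this
    simpa using this.symm
  | add_single n a ih =>
    obtain ⟨c, hc, ih⟩ := ih
    refine ⟨((a n + 1 : ℕ) : K) * c, mul_ne_zero (Nat.cast_ne_zero.mpr (by omega)) hc,
      fun d hd => ?_⟩
    rw [map_add, Finsupp.degree_single] at hd
    rw [pmon_add, pmon_single, coeff_psumSeries_mul]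
    have key : ∀ j ∈ d.support.filter fun j => (n : ℕ) ≤ d j,
        MvPowerSeries.coeff (d - Finsupp.single j (n : ℕ)) (pmon K a) =
          if d j = n then (if expType d = a + Finsupp.single n 1 then c else 0) else 0 := by
      intro j hj
      obtain ⟨_, hj⟩ := Finset.mem_filter.mp hj
      rcases hj.eq_or_lt with h | h
      · have h1 := expType_sub_single (n := n) h.symm
        have h2 := congrArg Finsupp.degree h1
        rw [map_add, degree_expType, degree_expType, Finsupp.degree_single] at h2
        rw [ih _ (by omega), if_pos h.symm, ← h1]
        simp
      · have h2 := congrArg Finset.card (card_support_sub_single h)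
        rw [ih _ (by omega), if_neg h.ne', if_neg]
        intro h3
        have h4 := degree_expType (d - Finsupp.single j (n : ℕ))
        rw [h3] at h4
        omega
    rw [Finset.sum_congr rfl key, ← Finset.sum_filter, Finset.filter_filter, Finset.sum_const]
    have hf : (d.support.filter fun j => (n : ℕ) ≤ d j ∧ d j = n) =
        d.support.filter fun j => d j = n :=
      Finset.filter_congr fun j _ => ⟨fun h => h.2, fun h => ⟨h.ge, h⟩⟩
    rw [hf, ← expType_apply]
    split_ifs with h
    · rw [h, nsmul_eq_mul]; simp
    · simp

theorem coe_ofPoly (P : MvPolynomial ℕ+ K) :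
    (ofPoly K P : MvPowerSeries ℕ K) = ∑ a ∈ P.support, MvPolynomial.coeff a P • pmon K a := by
  conv_lhs => rw [P.as_sum]
  rw [map_sum, AddSubmonoidClass.coe_finsetSum]
  exact Finset.sum_congr rfl fun a _ => coe_ofPoly_monomial a _

theorem ofPoly_injective [CharZero K] : Function.Injective (ofPoly K) := by
  classical
  rw [injective_iff_map_eq_zero]
  intro P hP
  by_contra hne
  obtain ⟨a, ha, hmax⟩ := Finset.exists_max_image P.support (fun a => a.degree)
    (MvPolynomial.support_nonempty.mpr hne)
  obtain ⟨d, hd⟩ := exists_expType a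
  have hcard : a.degree = d.support.card := by rw [← hd, degree_expType]
  have h0 : MvPowerSeries.coeff d (ofPoly K P : MvPowerSeries ℕ K) = 0 := by rw [hP]; rfl
  rw [coe_ofPoly, map_sum, Finset.sum_eq_single a] at h0
  · obtain ⟨c, hc, h⟩ := exists_coeff_pmon (K := K) a
    rw [map_smul, h d hcard.le, if_pos hd, smul_eq_mul] at h0
    exact (mul_ne_zero (MvPolynomial.mem_support_iff.mp ha) hc) h0
  · intro b hb hba
    obtain ⟨c, hc, h⟩ := exists_coeff_pmon (K := K) b
    rw [map_smul, h d (hcard ▸ hmax b hb), if_neg (by rw [hd]; exact hba.symm), smul_zero]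
  · exact fun h => absurd ha h

theorem exists_perm_of_expType_eq {d d' : ℕ →₀ ℕ} (h : expType d = expType d') :
    ∃ e : Equiv.Perm ℕ, d.mapDomain e = d' := by
  have key : ∀ c : ℕ, Nonempty ({j // d j = c} ≃ {j // d' j = c}) := by
    intro c
    rcases Nat.eq_zero_or_pos c with rfl | hc
    · have inf : ∀ u : ℕ →₀ ℕ, Infinite {j // u j = 0} := fun u => by
        refine Set.infinite_coe_iff.mpr ?_
        have := u.support.finite_toSet.infinite_compl
        have h0 : {j | u j = 0} = (u.support : Set ℕ)ᶜ := by
          ext j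
          simp
        rw [← h0] at this
        exact this
      have := inf d
      have := inf d'
      exact nonempty_equiv_of_countable
    · have hcard : ∀ u : ℕ →₀ ℕ, ∀ j, j ∈ (u.support.filter fun j => u j = c) ↔ u j = c := by
        intro u j
        rw [Finset.mem_filter, Finsupp.mem_support_iff]
        omega
      have h1 : (d.support.filter fun j => d j = c).card =
          (d'.support.filter fun j => d' j = c).card := by
        have h2 := DFunLike.congr_fun h (⟨c, hc⟩ : ℕ+)
        exact ((expType_apply d _).symm.trans h2).trans (expType_apply d' _)
      exact ⟨((Equiv.subtypeEquivRight (hcard d)).symm.trans (Finset.equivOfCardEq h1)).trans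
        (Equiv.subtypeEquivRight (hcard d'))⟩
  refine ⟨Equiv.ofFiberEquiv fun c => (key c).some, ?_⟩
  set e := Equiv.ofFiberEquiv fun c => (key c).some with he
  ext i
  obtain ⟨j, rfl⟩ := e.surjective i
  rw [Finsupp.mapDomain_apply e.injective]
  exact (Equiv.ofFiberEquiv_map (f := d) (g := d') (fun c => (key c).some) j).symm

theorem coeff_eq_of_expType_eq {f : MvPowerSeries ℕ K} (hf : f ∈ SymFun K) {d d' : ℕ →₀ ℕ}
    (h : expType d = expType d') : MvPowerSeries.coeff d f = MvPowerSeries.coeff d' f := by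
  obtain ⟨e, rfl⟩ := exists_perm_of_expType_eq h
  exact (coeff_mapDomain hf e d).symm

theorem finite_expType (N : ℕ) : {a | ∃ d : ℕ →₀ ℕ, d.degree ≤ N ∧ expType d = a}.Finite := by
  refine (Set.finite_Iic (∑ n ∈ Finset.range N, Finsupp.single n.succPNat N)).subset ?_
  rintro _ ⟨d, hd, rfl⟩
  refine Finsupp.le_def.mpr fun n => ?_
  by_cases hn : (n : ℕ) ≤ N
  · have h1 : expType d n ≤ N := by
      refine le_trans (Finsupp.le_degree n _) ?_
      rw [degree_expType]
      refine le_trans ?_ hd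
      rw [Finsupp.degree_apply, Finset.card_eq_sum_ones]
      refine Finset.sum_le_sum fun j hj => ?_
      exact Nat.one_le_iff_ne_zero.mpr (Finsupp.mem_support_iff.mp hj)
    refine h1.trans ?_
    rw [Finsupp.finsetSum_apply]
    have h2 := Finset.single_le_sum (f := fun i : ℕ => Finsupp.single i.succPNat N n)
      (fun _ _ => Nat.zero_le _) (Finset.mem_range.mpr (lt_of_lt_of_le (Nat.pred_lt n.ne_zero) hn))
    refine le_trans (le_of_eq ?_) h2
    have : (Nat.pred n).succPNat = n := PNat.succPNat_natPred n
    rw [this, Finsupp.single_eq_same]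
  · rw [expType_apply, Finset.card_eq_zero.mpr]
    · exact Nat.zero_le _
    · refine Finset.filter_eq_empty_iff.mpr fun j _ hj => hn ?_
      rw [← hj]
      exact (Finsupp.le_degree j d).trans hd

theorem ofPoly_surjective [CharZero K] : Function.Surjective (ofPoly K) := by
  classical
  suffices H : ∀ L : ℕ, ∀ f : SymFun K,
      (∀ d : ℕ →₀ ℕ, L ≤ d.support.card → MvPowerSeries.coeff d (f : MvPowerSeries ℕ K) = 0) →
      f ∈ (ofPoly K).range by
    intro f
    obtain ⟨N, hN⟩ := f.2.2
    refine H (N + 1) f fun d hd => hN d (lt_of_lt_of_le (Nat.lt_of_succ_le hd) ?_)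
    rw [Finsupp.degree_apply, Finset.card_eq_sum_ones]
    exact Finset.sum_le_sum fun j hj => Nat.one_le_iff_ne_zero.mpr (Finsupp.mem_support_iff.mp hj)
  intro L
  induction L with
  | zero =>
    intro f hf
    have : f = 0 := Subtype.ext (MvPowerSeries.ext fun d => hf d (Nat.zero_le _))
    rw [this]
    exact zero_mem _
  | succ L ih =>
    intro f hf
    obtain ⟨N, hN⟩ := f.2.2
    choose c hc hcoeff using exists_coeff_pmon (K := K)
    choose rep hrep using exists_expType
    let A := (finite_expType N).toFinset.filter fun a => a.degree = L
    let P : MvPolynomial ℕ+ K := ∑ a ∈ A, MvPolynomial.monomial a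
      (MvPowerSeries.coeff (rep a) (f : MvPowerSeries ℕ K) / c a)
    have hP : (ofPoly K P : MvPowerSeries ℕ K) = ∑ a ∈ A,
        (MvPowerSeries.coeff (rep a) (f : MvPowerSeries ℕ K) / c a) • pmon K a := by
      rw [map_sum, AddSubmonoidClass.coe_finsetSum]
      exact Finset.sum_congr rfl fun a _ => coe_ofPoly_monomial a _
    have h1 : f - ofPoly K P ∈ (ofPoly K).range := by
      refine ih _ fun d hd => ?_
      rw [AddSubgroupClass.coe_sub, map_sub, hP, map_sum]
      have h2 : ∀ a ∈ A, MvPowerSeries.coeff d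
          ((MvPowerSeries.coeff (rep a) (f : MvPowerSeries ℕ K) / c a) • pmon K a) =
          if expType d = a then MvPowerSeries.coeff d (f : MvPowerSeries ℕ K) else 0 := by
        intro a ha
        have ha := (Finset.mem_filter.mp ha).2
        rw [map_smul, hcoeff a d (by omega), smul_eq_mul]
        split_ifs with h
        · rw [div_mul_cancel₀ _ (hc a)]
          exact coeff_eq_of_expType_eq f.2 (by rw [hrep, h])
        · rw [mul_zero]
      rw [Finset.sum_congr rfl h2, Finset.sum_ite_eq]
      split_ifs with h
      · rw [sub_self]
      · rw [sub_zero]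
        rcases hd.eq_or_lt with h3 | h3
        · refine hN d (lt_of_not_ge fun h4 => h ?_)
          refine Finset.mem_filter.mpr ⟨?_, by rw [degree_expType, h3]⟩
          rw [Set.Finite.mem_toFinset]
          exact ⟨d, h4, rfl⟩
        · exact hf d h3
    have := add_mem h1 ⟨P, rfl⟩
    simpa using this

/-- `Λ` is the polynomial ring in the power sums `p₁, p₂, …`. -/
noncomputable def powerSumEquiv (K : Type*) [Field K] [CharZero K] :
    MvPolynomial ℕ+ K ≃ₐ[K] SymFun K :=
  AlgEquiv.ofBijective (ofPoly K) ⟨ofPoly_injective, ofPoly_surjective⟩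

/-- The basis `p_λ` of `Λ`. A partition `λ` is given by its multiplicities, `a n` being the number
of parts of `λ` equal to `n`. -/
noncomputable def powerSumBasis (K : Type*) [Field K] [CharZero K] :
    Module.Basis (ℕ+ →₀ ℕ) K (SymFun K) :=
  (MvPolynomial.basisMonomials ℕ+ K).map (powerSumEquiv K).toLinearEquiv

theorem powerSumBasis_apply [CharZero K] (a : ℕ+ →₀ ℕ) :
    powerSumBasis K a = a.prod fun n m => psum K n ^ m := by
  simp [powerSumBasis, powerSumEquiv, ofPoly, MvPolynomial.aeval_monomial]

theorem powerSumBasis_add [CharZero K] (a b : ℕ+ →₀ ℕ) :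
    powerSumBasis K (a + b) = powerSumBasis K a * powerSumBasis K b := by
  simp_rw [powerSumBasis_apply]
  exact Finsupp.prod_add_index' (fun _ => pow_zero _) (fun _ _ _ => pow_add _ _ _)

theorem powerSumBasis_repr [CharZero K] (f : SymFun K) (a : ℕ+ →₀ ℕ) :
    (powerSumBasis K).repr f a = MvPolynomial.coeff a ((powerSumEquiv K).symm f) := rfl

/-! ### The scalar product and adjoints of multiplication operators -/

/-- `z_λ = ∏ₙ n^{mₙ} mₙ!`. -/
def zee (a : ℕ+ →₀ ℕ) : ℕ := a.prod fun n m => (n : ℕ) ^ m * m.factorial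

theorem zee_ne_zero (a : ℕ+ →₀ ℕ) : zee a ≠ 0 :=
  Finset.prod_ne_zero_iff.mpr fun n _ =>
    mul_ne_zero (pow_ne_zero _ n.pos.ne') (Nat.factorial_ne_zero _)

/-- The scalar product on `Λ`, given by `⟨p_λ, p_μ⟩ = δ_{λμ} z_λ`. -/
noncomputable def hall (K : Type*) [Field K] [CharZero K] : LinearMap.BilinForm K (SymFun K) :=
  (powerSumBasis K).constr K fun a => (zee a : K) • (powerSumBasis K).coord a

theorem hall_basis_left [CharZero K] (a : ℕ+ →₀ ℕ) (f : SymFun K) :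
    hall K (powerSumBasis K a) f = zee a * (powerSumBasis K).repr f a := by
  rw [hall, Module.Basis.constr_basis]
  simp

theorem hall_basis_right [CharZero K] (f : SymFun K) (a : ℕ+ →₀ ℕ) :
    hall K f (powerSumBasis K a) = zee a * (powerSumBasis K).repr f a := by
  classical
  rw [hall, Module.Basis.constr_apply, Finsupp.sum, LinearMap.sum_apply]
  simp only [LinearMap.smul_apply, Module.Basis.coord_apply, Module.Basis.repr_self, smul_eq_mul,
    Finsupp.single_apply]
  rw [Finset.sum_eq_single a]
  · simp [mul_comm]
  · intro b _ hb
    simp [hb.symm]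
  · intro h
    simp [Finsupp.notMem_support_iff.mp h]

open Classical in
theorem hall_powerSumBasis [CharZero K] (a b : ℕ+ →₀ ℕ) :
    hall K (powerSumBasis K a) (powerSumBasis K b) = if a = b then (zee a : K) else 0 := by
  rw [hall_basis_left, Module.Basis.repr_self, Finsupp.single_apply]
  simp [eq_comm]

theorem ext_hall [CharZero K] {f g : SymFun K} (h : ∀ u, hall K f u = hall K g u) : f = g := by
  refine (powerSumBasis K).repr.injective (Finsupp.ext fun a => ?_)
  have := h (powerSumBasis K a)
  rw [hall_basis_right, hall_basis_right] at this
  exact mul_left_cancel₀ (Nat.cast_ne_zero.mpr (zee_ne_zero a)) this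

open Classical in
theorem repr_mul_basis [CharZero K] (f : SymFun K) (b c : ℕ+ →₀ ℕ) :
    (powerSumBasis K).repr (f * powerSumBasis K c) b =
      if c ≤ b then (powerSumBasis K).repr f (b - c) else 0 := by
  have : (powerSumEquiv K).symm (powerSumBasis K c) = MvPolynomial.monomial c 1 := by
    rw [AlgEquiv.symm_apply_eq]; simp [powerSumBasis]
  rw [powerSumBasis_repr, map_mul, this, MvPolynomial.coeff_mul_monomial', mul_one]
  rfl

theorem exists_perp [CharZero K] (f : SymFun K) :
    ∃ T : Module.End K (SymFun K), ∀ g u, hall K (T g) u = hall K g (f * u) := by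
  classical
  let T : Module.End K (SymFun K) :=
    (powerSumBasis K).constr K fun b => ∑ c ∈ (Set.finite_Iic b).toFinset,
      ((zee b : K) * (powerSumBasis K).repr f (b - c) / zee c) • powerSumBasis K c
  refine ⟨T, fun g u => ?_⟩
  refine LinearMap.congr_fun₂ (f := (hall K) ∘ₗ T)
    (g := (hall K).compl₂ (LinearMap.mulLeft K f)) ?_ g u
  refine (powerSumBasis K).ext fun b => (powerSumBasis K).ext fun c => ?_
  rw [LinearMap.comp_apply, Module.Basis.constr_basis, LinearMap.compl₂_apply,
    LinearMap.mulLeft_apply, hall_basis_left, repr_mul_basis, map_sum, LinearMap.sum_apply]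
  simp only [map_smul, LinearMap.smul_apply, hall_powerSumBasis, smul_eq_mul, mul_ite, mul_zero]
  rw [Finset.sum_ite_eq']
  simp only [Set.Finite.mem_toFinset, Set.mem_Iic]
  split_ifs
  · exact div_mul_cancel₀ _ (Nat.cast_ne_zero.mpr (zee_ne_zero c))
  · rfl

/-- `f^⊥`, the adjoint of multiplication by `f`. -/
noncomputable def perp [CharZero K] (f : SymFun K) : Module.End K (SymFun K) :=
  Classical.choose (exists_perp f)

theorem hall_perp [CharZero K] (f g u : SymFun K) :
    hall K (perp f g) u = hall K g (f * u) :=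
  Classical.choose_spec (exists_perp f) g u

theorem exists_perp_eq_zero [CharZero K] (b : ℕ+ →₀ ℕ) (f : SymFun K)
    (hf : ∀ a ≤ b, (powerSumBasis K).repr f a = 0) : perp f (powerSumBasis K b) = 0 := by
  classical
  refine ext_hall fun u => ?_
  rw [hall_perp, map_zero, LinearMap.zero_apply]
  refine LinearMap.congr_fun (f := (hall K (powerSumBasis K b)) ∘ₗ (LinearMap.mulLeft K f))
    (g := 0) ((powerSumBasis K).ext fun c => ?_) u
  rw [LinearMap.comp_apply, LinearMap.mulLeft_apply, hall_basis_left, repr_mul_basis,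
    hf _ tsub_le_self, ite_self, mul_zero, LinearMap.zero_apply]

/-! ### The vertex operators -/

/-- The plethystic substitution `f ↦ f[X(t - 1)]`, the algebra homomorphism with
`pₙ ↦ (tⁿ - 1) pₙ`. -/
noncomputable def pleth [CharZero K] (t : K) : SymFun K →ₐ[K] SymFun K :=
  (MvPolynomial.aeval fun n : ℕ+ => (t ^ (n : ℕ) - 1) • psum K n).comp
    (powerSumEquiv K).symm.toAlgHom

theorem pleth_basis [CharZero K] (t : K) (a : ℕ+ →₀ ℕ) :
    pleth t (powerSumBasis K a) =
      (a.prod fun n m => (t ^ (n : ℕ) - 1) ^ m) • powerSumBasis K a := by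
  have : (powerSumEquiv K).symm (powerSumBasis K a) = MvPolynomial.monomial a 1 := by
    rw [AlgEquiv.symm_apply_eq]; simp [powerSumBasis]
  have h2 : pleth t (powerSumBasis K a) =
      MvPolynomial.aeval (fun n : ℕ+ => (t ^ (n : ℕ) - 1) • psum K n)
        ((powerSumEquiv K).symm (powerSumBasis K a)) := rfl
  rw [h2, this, MvPolynomial.aeval_monomial, map_one, one_mul, powerSumBasis_apply]
  simp only [Finsupp.prod, smul_pow]
  rw [Finset.prod_smul]

theorem pleth_psum [CharZero K] (t : K) (n : ℕ+) :
    pleth t (psum K n) = (t ^ (n : ℕ) - 1) • psum K n := by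
  have h : powerSumBasis K (Finsupp.single n 1) = psum K n := by simp [powerSumBasis_apply]
  rw [← h, pleth_basis]
  simp

theorem repr_pleth [CharZero K] (t : K) (f : SymFun K) (a : ℕ+ →₀ ℕ) :
    (powerSumBasis K).repr (pleth t f) a =
      (a.prod fun n m => (t ^ (n : ℕ) - 1) ^ m) * (powerSumBasis K).repr f a := by
  classical
  refine LinearMap.congr_fun (f := (powerSumBasis K).coord a ∘ₗ (pleth t).toLinearMap)
    (g := (a.prod fun n m => (t ^ (n : ℕ) - 1) ^ m) • (powerSumBasis K).coord a)
    ((powerSumBasis K).ext fun b => ?_) f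
  simp only [LinearMap.comp_apply, AlgHom.toLinearMap_apply, pleth_basis, map_smul,
    Module.Basis.coord_apply, Module.Basis.repr_self, LinearMap.smul_apply, smul_eq_mul,
    Finsupp.single_apply]
  split_ifs with h
  · rw [h]
  · simp

/-- The size of the partition with multiplicities `a`. -/
noncomputable def wt : (ℕ+ →₀ ℕ) →+ ℕ := Finsupp.weight fun n : ℕ+ => (n : ℕ)

theorem coeff_pmon_eq_zero (a : ℕ+ →₀ ℕ) :
    ∀ d : ℕ →₀ ℕ, d.degree ≠ wt a → MvPowerSeries.coeff d (pmon K a) = 0 := by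
  classical
  induction a using finsupp_induction with
  | zero =>
    intro d hd
    rw [pmon_zero, MvPowerSeries.coeff_one, if_neg]
    rintro rfl
    simp at hd
  | add_single n a ih =>
    intro d hd
    rw [pmon_add, pmon_single, coeff_psumSeries_mul]
    refine Finset.sum_eq_zero fun j hj => ih _ fun h => hd ?_
    have h1 := tsub_add_cancel_of_le (Finsupp.single_le_iff.mpr (Finset.mem_filter.mp hj).2)
    have h2 : wt (Finsupp.single n 1) = n := by simp [wt, Finsupp.weight_apply]
    conv_lhs => rw [← h1]
    rw [map_add, map_add, h, h2, Finsupp.degree_single]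

theorem repr_hsymm_eq_zero [CharZero K] (r : ℤ) (a : ℕ+ →₀ ℕ) (ha : (wt a : ℤ) ≠ r) :
    (powerSumBasis K).repr (hsymm K r) a = 0 := by
  classical
  set P := (powerSumEquiv K).symm (hsymm K r) with hP
  have hP' : ofPoly K P = hsymm K r := (powerSumEquiv K).apply_symm_apply _
  let Q : MvPolynomial ℕ+ K :=
    ∑ b ∈ P.support with (wt b : ℤ) ≠ r, MvPolynomial.monomial b (MvPolynomial.coeff b P)
  have hQ : ofPoly K Q = 0 := by
    refine Subtype.ext (MvPowerSeries.ext fun d => ?_)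
    have h1 : (ofPoly K Q : MvPowerSeries ℕ K) = ∑ b ∈ P.support with (wt b : ℤ) ≠ r,
        MvPolynomial.coeff b P • pmon K b := by
      rw [map_sum, AddSubmonoidClass.coe_finsetSum]
      exact Finset.sum_congr rfl fun b _ => coe_ofPoly_monomial b _
    rw [h1, map_sum]
    change _ = (0 : K)
    by_cases hd : (d.degree : ℤ) = r
    · refine Finset.sum_eq_zero fun b hb => ?_
      rw [map_smul, coeff_pmon_eq_zero, smul_zero]
      intro h
      exact (Finset.mem_filter.mp hb).2 (by rw [← h, hd])
    · have h2 : MvPowerSeries.coeff d (ofPoly K P : MvPowerSeries ℕ K) = 0 := by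
        rw [hP', coeff_hsymm, if_neg hd]
      rw [coe_ofPoly, map_sum] at h2
      rw [← h2]
      refine Finset.sum_subset (Finset.filter_subset _ _) fun b hb hb' => ?_
      rw [map_smul, coeff_pmon_eq_zero, smul_zero]
      intro h
      exact hb' (Finset.mem_filter.mpr ⟨hb, fun h3 => hd (by rw [h, h3])⟩)
  have hQ0 : Q = 0 := ofPoly_injective (by rw [hQ, map_zero])
  have h3 : MvPolynomial.coeff a Q = 0 := by rw [hQ0, MvPolynomial.coeff_zero]
  rw [MvPolynomial.coeff_sum] at h3
  simp only [MvPolynomial.coeff_monomial] at h3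
  rw [Finset.sum_ite_eq'] at h3
  simp only [Finset.mem_filter] at h3
  rw [powerSumBasis_repr, ← hP]
  by_contra h
  exact h (by simpa [ha, MvPolynomial.mem_support_iff.mpr h] using h3)

theorem finite_vertex_support [CharZero K] (t : K) (ℓ : ℤ) (g : SymFun K) :
    (Function.support fun i : ℕ =>
      hsymm K (i + ℓ) * perp (pleth t (hsymm K i)) g).Finite := by
  have hg : g ∈ Submodule.span K (Set.range (powerSumBasis K)) := (powerSumBasis K).mem_span g
  induction hg using Submodule.span_induction with
  | zero => simp
  | mem x hx =>
    obtain ⟨b, rfl⟩ := hx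
    refine (Set.finite_Iic (wt b)).subset fun i hi => ?_
    by_contra h
    refine hi ?_
    simp only
    rw [exists_perp_eq_zero, mul_zero]
    intro a ha
    rw [repr_pleth, repr_hsymm_eq_zero, mul_zero]
    have h1 : wt a ≤ wt b := by
      rw [← tsub_add_cancel_of_le ha, map_add]
      exact Nat.le_add_left _ _
    have h2 : wt b < i := lt_of_not_ge h
    omega
  | add g g' _ _ h h' =>
    refine (h.union h').subset ?_
    simp only [map_add, mul_add]
    exact Function.support_add _ _
  | smul c g _ h =>
    refine h.subset ?_
    simp only [map_smul, mul_smul_comm]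
    exact Function.support_const_smul_subset c _

/-- The vertex operator `B_ℓ = ∑_{i ≥ 0} s_{i+ℓ}[X] · s_i[X(t-1)]^⊥`, for `ℓ ∈ ℤ`. -/
noncomputable def vertexOp [CharZero K] (t : K) (ℓ : ℤ) : Module.End K (SymFun K) where
  toFun g := ∑ᶠ i : ℕ, hsymm K (i + ℓ) * perp (pleth t (hsymm K i)) g
  map_add' g g' := by
    simp only [map_add, mul_add]
    exact finsum_add_distrib (finite_vertex_support t ℓ g) (finite_vertex_support t ℓ g')
  map_smul' c g := by
    simp only [map_smul, mul_smul_comm, RingHom.id_apply]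
    exact (smul_finsum' c (finite_vertex_support t ℓ g)).symm

/-- The operator `∏_{i<j} (1 - t e_{ij})` on formal linear combinations of index vectors of
length `L`, `e_{ij}` being the translation by `εᵢ - εⱼ`; it is an element of the group algebra
of `ℤ^L`, acting by multiplication. -/
noncomputable def raising (t : K) (L : ℕ) : AddMonoidAlgebra K (Fin L → ℤ) :=
  ∏ p : Fin L × Fin L with p.1 < p.2,
    (1 - AddMonoidAlgebra.single (Pi.single p.1 1 - Pi.single p.2 1) t)

/-- The operator `B_v = ∏_{i<j} (1 - t e_{ij}) B_{v₁} ⋯ B_{v_L}`. -/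
noncomputable def vertexVec [CharZero K] (t : K) {L : ℕ} (v : Fin L → ℤ) :
    Module.End K (SymFun K) :=
  Finsupp.sum (raising t L * AddMonoidAlgebra.single v 1).coeff fun w c =>
    c • (List.ofFn fun i => vertexOp t (w i)).prod

/-- `B_λ` for a partition `λ`, the index vector being the list of its nonzero parts. -/
noncomputable def vertexPartition [CharZero K] (t : K) (lam : YoungDiagram) :
    Module.End K (SymFun K) :=
  vertexVec t fun i : Fin (lam.colLen 0) => (lam.rowLen i : ℤ)

/-- `B_{ℓ^{k+1-ℓ}}`, the operator indexed by the `k`-rectangle with `k + 1 - ℓ` rows of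
length `ℓ`, for `ℓ ≤ k`. -/
noncomputable def vertexRect [CharZero K] (t : K) (k ℓ : ℕ) : Module.End K (SymFun K) :=
  vertexVec t fun _ : Fin (k + 1 - ℓ) => (ℓ : ℤ)

end SymFun

/-- The hook-length `a(s) + l(s) + 1` of a cell `s` of a Young diagram (meaningful for `s ∈ lam`). -/
def YoungDiagram.hookLen (lam : YoungDiagram) (s : ℕ × ℕ) : ℕ :=
  (lam.rowLen s.1 - (s.2 + 1)) + (lam.colLen s.2 - (s.1 + 1)) + 1

/-!
The proof rests on one quadratic relation between the vertex operators and on the straightening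
rule that it implies.

Write `B(z) = ∑ B_a zᵃ = H(z) Q(z)` with `H(z) = ∑ h_m zᵐ` and `Q(z) = ∑ h_i[X(t-1)]^⊥ z⁻ⁱ`. Newton's
identity, and the fact that `pₙ^⊥` is the derivation `n ∂/∂pₙ`, give
`(1 - t w/z) Q(z) H(w) = (1 - w/z) H(w) Q(z)` (`plethPerp_hsymm_mul`). Hence
`(1 - t w/z) B(z) B(w)` is `1 - w/z` times a normally ordered product which is symmetric in `z` and
`w`; comparing coefficients gives `HallLittlewoodRelation` for the `B_a` (`vertexOp_relation`).

What follows holds for every family `B` in an algebra that satisfies this relation. All factors of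
`∏_{i<j} (1 - t e_{ij})` but one are permuted by an adjacent transposition, so that
`B_{(…,a,b,…)} = -B_{(…,b-1,a+1,…)}`; in particular `B_v = 0` whenever `v_j - v_i = j - i` for some
`i < j` (`HallLittlewoodRelation.raisedWord_eq_zero`).

To compare `A B_b` with `B_b A` for a rectangle operator `A = B_{(ℓ,…,ℓ)}` with `n` rows, let `M_v` be
the operator obtained from `B_v`, `v` of length `n + 1`, by omitting the factor of the first and the
last position, so that `M_v - t M_{v + ε₀ - εₙ} = B_v`. The factors by which the definition of
`M_{(ℓ,…,ℓ,b)}` differs from `A B_b` contribute only terms with adjacent entries `ℓ, ℓ + 1`, which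
vanish, so that `M_{(ℓ,…,ℓ,b)} = A B_b`, and in the same way `M_{(b,ℓ,…,ℓ)} = B_b A`. Moving from one
vector to the other through the vectors `(a, ℓ, …, ℓ, a')` only meets vanishing `B_v` as long as
`|b - ℓ| < n`. Therefore `A B_b = t^(b-ℓ) B_b A` in this range, read as
`t^(ℓ-b) A B_b = B_b A` for `b < ℓ` (`HallLittlewoodRelation.rect_mul` and
`HallLittlewoodRelation.mul_rect`).

The range `|b - ℓ| < n` is larger than the one in the first assertion, and this is what yields the
second one: the raising operator changes each entry of `ν` by at most `r - 1`, and
`ν₁ + r - 1 = k` and `ν_r ≥ ℓ` then keep all indices in the expansion of `B_ν` within that range, so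
that `A` can be moved through each product of operators separately
(`HallLittlewoodRelation.rect_mul_raisedWord`).
-/

namespace SymFun

/-! ### Products of operators along an index vector -/

section Words

variable {K E : Type*} [Field K] [Ring E] [Algebra K E]

/-- The product `B v₀ * B v₁ * ⋯` of a family of operators along an index vector. -/
def wordProd (B : ℤ → E) {L : ℕ} (v : Fin L → ℤ) : E := (List.ofFn fun i => B (v i)).prod

theorem wordProd_cons (B : ℤ → E) {L : ℕ} (a : ℤ) (v : Fin L → ℤ) :
    wordProd B (Fin.cons a v : Fin (L + 1) → ℤ) = B a * wordProd B v := by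
  simp [wordProd, List.ofFn_succ]

theorem wordProd_snoc (B : ℤ → E) {L : ℕ} (v : Fin L → ℤ) (a : ℤ) :
    wordProd B (Fin.snoc v a : Fin (L + 1) → ℤ) = wordProd B v * B a := by
  rw [wordProd, List.ofFn_succ']
  simp [wordProd]

/-- The dependence of a product of operators on two adjacent entries of the index vector. -/
theorem exists_wordProd_eq_adjacent (B : ℤ → E) {L : ℕ} (p : Fin L) (w : Fin (L + 1) → ℤ) :
    ∃ P Q : E, ∀ v : Fin (L + 1) → ℤ, (∀ i, i ≠ p.castSucc → i ≠ p.succ → v i = w i) →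
      wordProd B v = P * (B (v p.castSucc) * B (v p.succ)) * Q := by
  induction L with
  | zero => exact p.elim0
  | succ L ih =>
    refine Fin.cases ?_ (fun p => ?_) p
    · refine ⟨1, wordProd B (Fin.tail (Fin.tail w)), fun v hv => ?_⟩
      have h : Fin.tail (Fin.tail w) = Fin.tail (Fin.tail v) := by
        funext i
        exact (hv i.succ.succ (Fin.succ_ne_zero _) (by
          rw [ne_eq, Fin.succ_inj]; exact Fin.succ_ne_zero _)).symm
      rw [h]
      conv_lhs => rw [← Fin.cons_self_tail v, ← Fin.cons_self_tail (Fin.tail v)]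
      rw [wordProd_cons, wordProd_cons, one_mul, mul_assoc]
      rfl
    · obtain ⟨P, Q, h⟩ := ih p (Fin.tail w)
      refine ⟨B (w 0) * P, Q, fun v hv => ?_⟩
      rw [← Fin.cons_self_tail v, wordProd_cons, h (Fin.tail v) fun i h1 h2 => ?_]
      · rw [hv 0 (by simp [Fin.ext_iff]) (Fin.succ_ne_zero _).symm]
        simp only [mul_assoc]
        rfl
      · exact hv i.succ (by rw [← Fin.succ_castSucc]; simpa using h1) (by simpa using h2)

/-- The linear map that replaces each index vector in a formal combination by the corresponding
product of operators. -/
noncomputable def evalWords (K : Type*) {E : Type*} [Field K] [Ring E] [Algebra K E] (B : ℤ → E)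
    (L : ℕ) : AddMonoidAlgebra K (Fin L → ℤ) →ₗ[K] E :=
  (Finsupp.lsum K fun v => LinearMap.toSpanSingleton K E (wordProd B v)) ∘ₗ
    (AddMonoidAlgebra.coeffLinearEquiv K).toLinearMap

theorem evalWords_single (B : ℤ → E) {L : ℕ} (v : Fin L → ℤ) (c : K) :
    evalWords K B L (.single v c) = c • wordProd B v := by
  simp [evalWords]

end Words

/-! ### The straightening rule -/

section Straightening

variable {K E : Type*} [Field K] [Ring E] [Algebra K E]

/-- The factor `1 - t e_{ij}` of the raising operator. -/
noncomputable def raisingFactor (t : K) {L : ℕ} (i j : Fin L) : AddMonoidAlgebra K (Fin L → ℤ) :=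
  1 - AddMonoidAlgebra.single (Pi.single i 1 - Pi.single j 1) t

theorem raising_eq_prod (t : K) (L : ℕ) :
    raising t L = ∏ p : Fin L × Fin L with p.1 < p.2, raisingFactor t p.1 p.2 := rfl

theorem raisingFactor_mul_single (t : K) {L : ℕ} (i j : Fin L) (v : Fin L → ℤ) (c : K) :
    raisingFactor t i j * AddMonoidAlgebra.single v c =
      AddMonoidAlgebra.single v c -
        t • AddMonoidAlgebra.single (v + Pi.single i 1 - Pi.single j 1) c := by
  rw [raisingFactor, sub_mul, one_mul, AddMonoidAlgebra.single_mul_single,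
    AddMonoidAlgebra.smul_single, smul_eq_mul, add_comm, add_sub_assoc]

/-- The operator `∏_{i<j} (1 - t e_{ij}) B_{v₁} ⋯ B_{v_L}` attached to a family `B` of elements of
an algebra. -/
noncomputable def raisedWord (B : ℤ → E) (t : K) {L : ℕ} (v : Fin L → ℤ) : E :=
  evalWords K B L (raising t L * AddMonoidAlgebra.single v 1)

/-- The quadratic relation
`B_a B_b - t B_{a+1} B_{b-1} = -(B_{b-1} B_{a+1} - t B_b B_a)`, the coefficientwise form of
`(1 - t w/z) B(z) B(w) = -(w/z) (1 - t z/w) B(w) B(z)` for `B(z) = ∑ B_a zᵃ`. -/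
def HallLittlewoodRelation (B : ℤ → E) (t : K) : Prop :=
  ∀ a b : ℤ, B a * B b - t • (B (a + 1) * B (b - 1)) =
    -(B (b - 1) * B (a + 1) - t • (B b * B a))

/-- Permutation of the entries of the index vectors, `v ↦ v ∘ e`. -/
noncomputable def permuteWords (K : Type*) [Field K] {L : ℕ} (e : Equiv.Perm (Fin L)) :
    AddMonoidAlgebra K (Fin L → ℤ) →+* AddMonoidAlgebra K (Fin L → ℤ) :=
  AddMonoidAlgebra.mapDomainRingHom K (LinearMap.funLeft ℤ ℤ e).toAddMonoidHom

theorem permuteWords_single {L : ℕ} (e : Equiv.Perm (Fin L)) (v : Fin L → ℤ) (c : K) :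
    permuteWords K e (.single v c) = .single (v ∘ e) c := by
  simp [permuteWords]
  rfl

theorem permuteWords_raisingFactor (t : K) {L : ℕ} (e : Equiv.Perm (Fin L)) (i j : Fin L) :
    permuteWords K e (raisingFactor t i j) = raisingFactor t (e.symm i) (e.symm j) := by
  have h : ∀ i : Fin L, (Pi.single i 1 : Fin L → ℤ) ∘ e = Pi.single (e.symm i) 1 := fun i => by
    funext k
    simp [Pi.single_apply, Equiv.eq_symm_apply]
  have h2 : ∀ f g : Fin L → ℤ, (f - g) ∘ e = f ∘ e - g ∘ e := fun _ _ => rfl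
  rw [raisingFactor, map_sub, map_one, permuteWords_single, h2, h, h, raisingFactor]

variable {B : ℤ → E} {t : K}

theorem HallLittlewoodRelation.evalWords_raisingFactor_mul_single
    (hB : HallLittlewoodRelation B t) {L : ℕ} (p : Fin L) (w : Fin (L + 1) → ℤ) (c : K) :
    evalWords K B (L + 1) (raisingFactor t p.castSucc p.succ * .single w c) =
      -evalWords K B (L + 1) (raisingFactor t p.castSucc p.succ *
        .single (w ∘ Equiv.swap p.castSucc p.succ + Pi.single p.succ 1 - Pi.single p.castSucc 1)
          c) := by
  obtain ⟨P, Q, h⟩ := exists_wordProd_eq_adjacent B p w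
  have hne : p.castSucc ≠ p.succ := (Fin.castSucc_lt_succ).ne
  rw [raisingFactor_mul_single, raisingFactor_mul_single, map_sub, map_sub, map_smul, map_smul]
  simp only [evalWords_single]
  rw [h w fun _ _ _ => rfl, h, h, h]
  · have key := hB (w p.castSucc) (w p.succ)
    simp [hne, hne.symm] at key ⊢
    rw [smul_comm t c, smul_comm t c, ← smul_sub, ← smul_sub]
    congr 1
    simpa [mul_sub, sub_mul] using congrArg (fun x => P * x * Q) key
  · intro i h1 h2
    simp [h1, h2, Equiv.swap_apply_of_ne_of_ne]
  · intro i h1 h2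
    simp [h1, h2, Equiv.swap_apply_of_ne_of_ne]
  · intro i h1 h2
    simp [h1, h2]

/-- The quadratic relation at two adjacent positions, for arbitrary formal combinations of index
vectors. -/
theorem HallLittlewoodRelation.evalWords_raisingFactor_mul (hB : HallLittlewoodRelation B t) {L : ℕ}
    (p : Fin L) (x : AddMonoidAlgebra K (Fin (L + 1) → ℤ)) :
    evalWords K B (L + 1) (raisingFactor t p.castSucc p.succ * x) =
      -evalWords K B (L + 1) (raisingFactor t p.castSucc p.succ *
        (permuteWords K (Equiv.swap p.castSucc p.succ) x *
          .single (Pi.single p.succ 1 - Pi.single p.castSucc 1) 1)) := by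
  induction x using AddMonoidAlgebra.induction_linear with
  | zero => simp
  | add f g hf hg => rw [mul_add, map_add, hf, hg, map_add, add_mul, mul_add, map_add, neg_add]
  | single w c =>
    rw [hB.evalWords_raisingFactor_mul_single, permuteWords_single,
      AddMonoidAlgebra.single_mul_single, mul_one, add_sub_assoc]

/-- An adjacent transposition permutes the factors of the raising operator, apart from the factor of
the two transposed positions. -/
theorem raising_eq_raisingFactor_mul (t : K) {L : ℕ} (p : Fin L) :
    ∃ R : AddMonoidAlgebra K (Fin (L + 1) → ℤ),
      raising t (L + 1) = raisingFactor t p.castSucc p.succ * R ∧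
        permuteWords K (Equiv.swap p.castSucc p.succ) R = R := by
  refine ⟨∏ x ∈ (Finset.univ.filter fun x : Fin (L + 1) × Fin (L + 1) => x.1 < x.2).erase
    (p.castSucc, p.succ), raisingFactor t x.1 x.2, ?_, ?_⟩
  · have hp : (p.castSucc, p.succ) ∈
        Finset.univ.filter fun x : Fin (L + 1) × Fin (L + 1) => x.1 < x.2 := by simp
    rw [raising_eq_prod, ← Finset.mul_prod_erase _ _ hp]
  · rw [map_prod]
    simp_rw [permuteWords_raisingFactor, Equiv.symm_swap]
    refine Finset.prod_equiv ((Equiv.swap p.castSucc p.succ).prodCongr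
      (Equiv.swap p.castSucc p.succ)) ?_ fun x _ => rfl
    rintro ⟨i, j⟩
    simp only [Finset.mem_erase, Finset.mem_filter, Finset.mem_univ, true_and,
      Equiv.prodCongr_apply, Prod.map, ne_eq, Prod.mk.injEq, Equiv.swap_apply_def, Fin.ext_iff,
      Fin.lt_def]
    split_ifs <;> simp_all <;> omega

/-- The straightening rule `B_{(…,a,b,…)} = -B_{(…,b-1,a+1,…)}`. -/
theorem HallLittlewoodRelation.raisedWord_swap (hB : HallLittlewoodRelation B t) {L : ℕ}
    (p : Fin L) (v : Fin (L + 1) → ℤ) :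
    raisedWord B t v = -raisedWord B t
      (v ∘ Equiv.swap p.castSucc p.succ + (Pi.single p.succ 1 - Pi.single p.castSucc 1)) := by
  obtain ⟨R, hR, hs⟩ := raising_eq_raisingFactor_mul t p
  rw [raisedWord, raisedWord, hR, mul_assoc, hB.evalWords_raisingFactor_mul,
    (permuteWords K _).map_mul, hs, permuteWords_single, mul_assoc R,
    AddMonoidAlgebra.single_mul_single, mul_one, mul_assoc]

/-- For neighbouring positions the straightening rule maps `v` to itself with a sign; the general
case is reduced to this one by moving the entry `v j` to the left, where it loses `1` at each step. -/
theorem HallLittlewoodRelation.raisedWord_eq_zero [CharZero K] (hB : HallLittlewoodRelation B t)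
    {L : ℕ} (d : ℕ) (i j : Fin L) (hd : (j : ℕ) = i + d + 1) (v : Fin L → ℤ)
    (hv : v j = v i + (d + 1)) : raisedWord B t v = 0 := by
  obtain _ | L := L
  · exact i.elim0
  induction d generalizing j v with
  | zero =>
    obtain ⟨p, rfl⟩ : ∃ p : Fin L, p.castSucc = i := ⟨⟨i, by omega⟩, rfl⟩
    obtain rfl : j = p.succ := Fin.ext (by simpa using hd)
    have h := hB.raisedWord_swap p v
    have hfix : v ∘ Equiv.swap p.castSucc p.succ +
        (Pi.single p.succ 1 - Pi.single p.castSucc 1) = v := by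
      funext k
      have hne : p.castSucc ≠ p.succ := (Fin.castSucc_lt_succ).ne
      by_cases h1 : k = p.castSucc
      · subst h1; simp [hne, hv]
      · by_cases h2 : k = p.succ
        · subst h2; simp [hne.symm, hv]
        · simp [h1, h2, Equiv.swap_apply_of_ne_of_ne]
    rw [hfix, eq_neg_iff_add_eq_zero, ← two_smul K] at h
    exact (smul_eq_zero.mp h).resolve_left two_ne_zero
  | succ d ih =>
    obtain ⟨p, rfl⟩ : ∃ p : Fin L, p.succ = j :=
      ⟨⟨j - 1, by omega⟩, Fin.ext (by simp; omega)⟩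
    rw [Fin.val_succ] at hd
    have h1 : i ≠ p.castSucc := by rw [ne_eq, Fin.ext_iff]; simp; omega
    have h2 : i ≠ p.succ := by rw [ne_eq, Fin.ext_iff]; simp; omega
    have hne : p.castSucc ≠ p.succ := (Fin.castSucc_lt_succ).ne
    rw [hB.raisedWord_swap p v, ih p.castSucc (by simp; omega), neg_zero]
    simp [hne, h1, h2, Equiv.swap_apply_of_ne_of_ne, hv]
    ring

end Straightening

/-! ### Concatenation of index vectors -/

section Concatenation

variable {K E : Type*} [Field K] [Ring E] [Algebra K E]

/-- The ring homomorphism appending a last entry `0` to the index vectors. -/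
noncomputable def snocWords (K : Type*) [Field K] (L : ℕ) :
    AddMonoidAlgebra K (Fin L → ℤ) →+* AddMonoidAlgebra K (Fin (L + 1) → ℤ) :=
  AddMonoidAlgebra.mapDomainRingHom K
    { toFun := fun v => (Fin.snoc v 0 : Fin (L + 1) → ℤ)
      map_zero' := by funext i; refine Fin.lastCases ?_ (fun i => ?_) i <;> simp
      map_add' := fun v w => by funext i; refine Fin.lastCases ?_ (fun i => ?_) i <;> simp }

/-- The ring homomorphism prepending a first entry `0` to the index vectors. -/
noncomputable def consWords (K : Type*) [Field K] (L : ℕ) :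
    AddMonoidAlgebra K (Fin L → ℤ) →+* AddMonoidAlgebra K (Fin (L + 1) → ℤ) :=
  AddMonoidAlgebra.mapDomainRingHom K
    { toFun := fun v => (Fin.cons 0 v : Fin (L + 1) → ℤ)
      map_zero' := by funext i; refine Fin.cases ?_ (fun i => ?_) i <;> simp
      map_add' := fun v w => by funext i; refine Fin.cases ?_ (fun i => ?_) i <;> simp }

theorem snocWords_single {L : ℕ} (v : Fin L → ℤ) (c : K) :
    snocWords K L (.single v c) = .single (Fin.snoc v 0) c := by
  simp [snocWords]

theorem consWords_single {L : ℕ} (v : Fin L → ℤ) (c : K) :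
    consWords K L (.single v c) = .single (Fin.cons 0 v) c := by
  simp [consWords]

theorem snocWords_raisingFactor (t : K) {L : ℕ} (i j : Fin L) :
    snocWords K L (raisingFactor t i j) = raisingFactor t i.castSucc j.castSucc := by
  have h : (Fin.snoc (Pi.single i 1 - Pi.single j 1 : Fin L → ℤ) 0 : Fin (L + 1) → ℤ) =
      Pi.single i.castSucc 1 - Pi.single j.castSucc 1 := by
    funext k
    refine Fin.lastCases ?_ (fun k => ?_) k <;> simp [Pi.single_apply, (Fin.castSucc_lt_last _).ne']
  rw [raisingFactor, map_sub, map_one, snocWords_single, h, raisingFactor]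

theorem consWords_raisingFactor (t : K) {L : ℕ} (i j : Fin L) :
    consWords K L (raisingFactor t i j) = raisingFactor t i.succ j.succ := by
  have h : (Fin.cons 0 (Pi.single i 1 - Pi.single j 1 : Fin L → ℤ) : Fin (L + 1) → ℤ) =
      Pi.single i.succ 1 - Pi.single j.succ 1 := by
    funext k
    refine Fin.cases ?_ (fun k => ?_) k <;> simp [Pi.single_apply, (Fin.succ_ne_zero _).symm]
  rw [raisingFactor, map_sub, map_one, consWords_single, h, raisingFactor]

theorem consWords_snocWords {L : ℕ} (x : AddMonoidAlgebra K (Fin L → ℤ)) :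
    consWords K (L + 1) (snocWords K L x) = snocWords K (L + 1) (consWords K L x) := by
  induction x using AddMonoidAlgebra.induction_linear with
  | zero => simp
  | add f g hf hg => simp only [map_add, hf, hg]
  | single w c =>
    rw [snocWords_single, consWords_single, consWords_single, snocWords_single,
      Fin.cons_snoc_eq_snoc_cons]

theorem raising_eq_prod_prod (t : K) (L : ℕ) :
    raising t L = ∏ i : Fin L, ∏ j : Fin L, if i < j then raisingFactor t i j else 1 := by
  rw [raising_eq_prod, Finset.prod_filter, Fintype.prod_prod_type]

theorem raising_succ_eq_snocWords (t : K) (L : ℕ) :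
    raising t (L + 1) =
      snocWords K L (raising t L) * ∏ i : Fin L, raisingFactor t i.castSucc (Fin.last L) := by
  rw [raising_eq_prod_prod, raising_eq_prod_prod, Fin.prod_univ_castSucc]
  simp only [Fin.prod_univ_castSucc (n := L), Fin.castSucc_lt_castSucc_iff, Fin.castSucc_lt_last,
    if_true, Fin.not_lt.mpr (Fin.le_last _), if_false, Finset.prod_const_one, mul_one,
    Finset.prod_mul_distrib, map_prod]
  congr 1
  refine Finset.prod_congr rfl fun i _ => Finset.prod_congr rfl fun j _ => ?_
  split_ifs
  · rw [snocWords_raisingFactor]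
  · rw [map_one]

theorem raising_succ_eq_consWords (t : K) (L : ℕ) :
    raising t (L + 1) =
      consWords K L (raising t L) * ∏ j : Fin L, raisingFactor t 0 j.succ := by
  rw [raising_eq_prod_prod, raising_eq_prod_prod, Fin.prod_univ_succ, mul_comm]
  simp only [Fin.prod_univ_succ (n := L), Fin.succ_lt_succ_iff, Fin.succ_pos,
    if_true, Fin.not_lt_zero, if_false, one_mul, map_prod]
  congr 1
  refine Finset.prod_congr rfl fun i _ => Finset.prod_congr rfl fun j _ => ?_
  split_ifs
  · rw [consWords_raisingFactor]
  · rw [map_one]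

theorem evalWords_snocWords_mul (B : ℤ → E) {L : ℕ} (x : AddMonoidAlgebra K (Fin L → ℤ))
    (v : Fin L → ℤ) (b : ℤ) :
    evalWords K B (L + 1) (snocWords K L x * .single (Fin.snoc v b) 1) =
      evalWords K B L (x * .single v 1) * B b := by
  induction x using AddMonoidAlgebra.induction_linear with
  | zero => simp
  | add f g hf hg => simp only [map_add, add_mul, hf, hg]
  | single w c =>
    have h : (Fin.snoc w 0 + Fin.snoc v b : Fin (L + 1) → ℤ) = Fin.snoc (w + v) b := by
      funext k
      refine Fin.lastCases ?_ (fun k => ?_) k <;> simp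
    rw [snocWords_single, AddMonoidAlgebra.single_mul_single, AddMonoidAlgebra.single_mul_single,
      evalWords_single, evalWords_single, h, wordProd_snoc, smul_mul_assoc]

theorem evalWords_consWords_mul (B : ℤ → E) {L : ℕ} (x : AddMonoidAlgebra K (Fin L → ℤ))
    (v : Fin L → ℤ) (b : ℤ) :
    evalWords K B (L + 1) (consWords K L x * .single (Fin.cons b v) 1) =
      B b * evalWords K B L (x * .single v 1) := by
  induction x using AddMonoidAlgebra.induction_linear with
  | zero => simp
  | add f g hf hg => simp only [map_add, add_mul, mul_add, hf, hg]
  | single w c =>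
    have h : (Fin.cons 0 w + Fin.cons b v : Fin (L + 1) → ℤ) = Fin.cons b (w + v) := by
      funext k
      refine Fin.cases ?_ (fun k => ?_) k <;> simp
    rw [consWords_single, AddMonoidAlgebra.single_mul_single, AddMonoidAlgebra.single_mul_single,
      evalWords_single, evalWords_single, h, wordProd_cons, mul_smul_comm]

end Concatenation

/-! ### Rectangles and single operators -/

section Rectangles

variable {K E : Type*} [Field K] [Ring E] [Algebra K E]

/-- The raising operator without its factor for the first and the last position, written as the
raising operator on all positions but the last times the remaining factors. -/
noncomputable def raisingOpen (t : K) (N : ℕ) : AddMonoidAlgebra K (Fin (N + 2) → ℤ) :=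
  (∏ i : Fin N, raisingFactor t i.succ.castSucc (Fin.last (N + 1))) *
    snocWords K (N + 1) (raising t (N + 1))

/-- The same operator, as the raising operator on all positions but the first times the remaining
factors. -/
theorem raisingOpen_eq_consWords (t : K) (N : ℕ) :
    raisingOpen t N = (∏ i : Fin N, raisingFactor t 0 i.castSucc.succ) *
      consWords K (N + 1) (raising t (N + 1)) := by
  rw [raisingOpen]
  conv_lhs => rw [raising_succ_eq_consWords t N, map_mul, map_prod]
  conv_rhs => rw [raising_succ_eq_snocWords t N, map_mul, map_prod, consWords_snocWords]
  simp only [snocWords_raisingFactor, consWords_raisingFactor, Fin.castSucc_zero, Fin.succ_last,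
    Fin.succ_castSucc]
  ring

theorem raising_eq_raisingOpen_mul (t : K) (N : ℕ) :
    raising t (N + 2) = raisingFactor t 0 (Fin.last (N + 1)) * raisingOpen t N := by
  rw [raising_succ_eq_snocWords t (N + 1), Fin.prod_univ_succ, raisingOpen, Fin.castSucc_zero]
  ring

/-- The operator obtained from `B_v` by leaving out the raising factor of the first and the last
position. -/
noncomputable def raisedWordOpen (B : ℤ → E) (t : K) {N : ℕ} (v : Fin (N + 2) → ℤ) : E :=
  evalWords K B (N + 2) (raisingOpen t N * .single v 1)

theorem raisedWordOpen_sub (B : ℤ → E) (t : K) {N : ℕ} (v : Fin (N + 2) → ℤ) :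
    raisedWordOpen B t v -
      t • raisedWordOpen B t (v + Pi.single 0 1 - Pi.single (Fin.last (N + 1)) 1) =
        raisedWord B t v := by
  rw [raisedWord, raising_eq_raisingOpen_mul, mul_comm (raisingFactor _ _ _), mul_assoc,
    raisingFactor_mul_single, mul_sub, map_sub, mul_smul_comm, map_smul]
  rfl

/-- The index vector `(a, ℓ, …, ℓ, b)` with `N` entries `ℓ`. -/
def endsWord (N : ℕ) (ℓ a b : ℤ) : Fin (N + 2) → ℤ :=
  Fin.cons a (Fin.snoc (fun _ : Fin N => ℓ) b : Fin (N + 1) → ℤ)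

theorem raisedWordOpen_endsWord_of_eq_zero (B : ℤ → E) (t : K) (N : ℕ) (ℓ a b : ℤ)
    (h : raisedWord B t (endsWord N ℓ a b) = 0) :
    raisedWordOpen B t (endsWord N ℓ a b) =
      t • raisedWordOpen B t (endsWord N ℓ (a + 1) (b - 1)) := by
  rw [← raisedWordOpen_sub, sub_eq_zero] at h
  rw [h]
  congr 2
  funext k
  refine Fin.cases ?_ (fun k => ?_) k
  · simp [endsWord]
  · refine Fin.lastCases ?_ (fun k => ?_) k
    · simp [endsWord]
    · simp [endsWord]

variable [CharZero K] {B : ℤ → E} {t : K}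

/-- Raising an entry of a constant vector other than the first creates adjacent entries
`ℓ, ℓ + 1`, so that the raising factors with a further position act trivially. For the induction
over these factors, `v` only has to be constant up to the last position that they raise. -/
theorem HallLittlewoodRelation.evalWords_prod_snocWords (hB : HallLittlewoodRelation B t) {N : ℕ}
    (ℓ : ℤ) (S : Finset (Fin N)) (v : Fin (N + 1) → ℤ) (b : ℤ)
    (hv : ∀ i : Fin (N + 1), (∃ s ∈ S, i ≤ s.succ) → v i = ℓ) :
    evalWords K B (N + 2) ((∏ i ∈ S, raisingFactor t i.succ.castSucc (Fin.last (N + 1))) *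
      snocWords K (N + 1) (raising t (N + 1)) * .single (Fin.snoc v b) 1) =
        raisedWord B t v * B b := by
  induction S using Finset.induction_on_max generalizing v b with
  | empty => rw [Finset.prod_empty, one_mul, evalWords_snocWords_mul, raisedWord]
  | insert a S hS ih =>
    have hshift : (Fin.snoc v b + Pi.single a.succ.castSucc 1 - Pi.single (Fin.last (N + 1)) 1 :
        Fin (N + 2) → ℤ) = Fin.snoc (v + Pi.single a.succ 1) (b - 1) := by
      funext k
      refine Fin.lastCases ?_ (fun k => ?_) k <;>
        simp [Pi.single_apply, (Fin.castSucc_lt_last _).ne', -Fin.castSucc_succ]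
    have hzero : raisedWord B t (v + Pi.single a.succ 1) = 0 := by
      refine hB.raisedWord_eq_zero 0 a.castSucc a.succ (by simp) _ ?_
      have h1 : v a.castSucc = ℓ :=
        hv _ ⟨a, Finset.mem_insert_self _ _, (Fin.castSucc_lt_succ).le⟩
      have h2 : v a.succ = ℓ := hv _ ⟨a, Finset.mem_insert_self _ _, le_rfl⟩
      simp [h1, h2, (Fin.castSucc_lt_succ).ne]
    rw [Finset.prod_insert fun h => (hS a h).false, mul_assoc (raisingFactor _ _ _),
      mul_comm (raisingFactor _ _ _), mul_assoc, raisingFactor_mul_single, mul_sub, map_sub,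
      mul_smul_comm, map_smul, hshift, ih, ih, hzero, zero_mul, smul_zero, sub_zero]
    · rintro i ⟨s, hs, hi⟩
      have h1 : i < a.succ := hi.trans_lt (Fin.succ_lt_succ_iff.mpr (hS s hs))
      rw [Pi.add_apply, hv i ⟨s, Finset.mem_insert_of_mem hs, hi⟩, Pi.single_eq_of_ne h1.ne,
        add_zero]
    · rintro i ⟨s, hs, hi⟩
      exact hv i ⟨s, Finset.mem_insert_of_mem hs, hi⟩

/-- Lowering an entry of a constant vector other than the last creates adjacent entries
`ℓ - 1, ℓ`, so that the raising factors with a preceding position act trivially. -/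
theorem HallLittlewoodRelation.evalWords_prod_consWords (hB : HallLittlewoodRelation B t) {N : ℕ}
    (ℓ : ℤ) (S : Finset (Fin N)) (v : Fin (N + 1) → ℤ) (b : ℤ)
    (hv : ∀ i : Fin (N + 1), (∃ s ∈ S, s.castSucc ≤ i) → v i = ℓ) :
    evalWords K B (N + 2) ((∏ i ∈ S, raisingFactor t 0 i.castSucc.succ) *
      consWords K (N + 1) (raising t (N + 1)) * .single (Fin.cons b v) 1) =
        B b * raisedWord B t v := by
  induction S using Finset.induction_on_min generalizing v b with
  | empty => rw [Finset.prod_empty, one_mul, evalWords_consWords_mul, raisedWord]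
  | insert a S hS ih =>
    have hshift : (Fin.cons b v + Pi.single 0 1 - Pi.single a.castSucc.succ 1 :
        Fin (N + 2) → ℤ) = Fin.cons (b + 1) (v - Pi.single a.castSucc 1) := by
      funext k
      refine Fin.cases ?_ (fun k => ?_) k <;>
        simp [Pi.single_apply, (Fin.succ_ne_zero _).symm]
    have hzero : raisedWord B t (v - Pi.single a.castSucc 1) = 0 := by
      refine hB.raisedWord_eq_zero 0 a.castSucc a.succ (by simp) _ ?_
      have h1 : v a.succ = ℓ :=
        hv _ ⟨a, Finset.mem_insert_self _ _, (Fin.castSucc_lt_succ).le⟩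
      have h2 : v a.castSucc = ℓ := hv _ ⟨a, Finset.mem_insert_self _ _, le_rfl⟩
      simp [h1, h2, (Fin.castSucc_lt_succ).ne']
    rw [Finset.prod_insert fun h => (hS a h).false, mul_assoc (raisingFactor _ _ _),
      mul_comm (raisingFactor _ _ _), mul_assoc, raisingFactor_mul_single, mul_sub, map_sub,
      mul_smul_comm, map_smul, hshift, ih, ih, hzero, mul_zero, smul_zero, sub_zero]
    · rintro i ⟨s, hs, hi⟩
      have h1 : a.castSucc < i := (Fin.castSucc_lt_castSucc_iff.mpr (hS s hs)).trans_le hi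
      rw [Pi.sub_apply, hv i ⟨s, Finset.mem_insert_of_mem hs, hi⟩, Pi.single_eq_of_ne h1.ne',
        sub_zero]
    · rintro i ⟨s, hs, hi⟩
      exact hv i ⟨s, Finset.mem_insert_of_mem hs, hi⟩

theorem HallLittlewoodRelation.raisedWordOpen_snoc (hB : HallLittlewoodRelation B t) {N : ℕ}
    (ℓ b : ℤ) :
    raisedWordOpen B t (Fin.snoc (fun _ : Fin (N + 1) => ℓ) b : Fin (N + 2) → ℤ) =
      raisedWord B t (fun _ : Fin (N + 1) => ℓ) * B b :=
  hB.evalWords_prod_snocWords ℓ Finset.univ _ b fun _ _ => rfl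

theorem HallLittlewoodRelation.raisedWordOpen_cons (hB : HallLittlewoodRelation B t) {N : ℕ}
    (ℓ b : ℤ) :
    raisedWordOpen B t (Fin.cons b (fun _ : Fin (N + 1) => ℓ) : Fin (N + 2) → ℤ) =
      B b * raisedWord B t (fun _ : Fin (N + 1) => ℓ) := by
  rw [raisedWordOpen, raisingOpen_eq_consWords]
  exact hB.evalWords_prod_consWords ℓ Finset.univ _ b fun _ _ => rfl

theorem endsWord_left (N : ℕ) (ℓ b : ℤ) :
    endsWord N ℓ ℓ b = Fin.snoc (fun _ : Fin (N + 1) => ℓ) b := by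
  rw [endsWord, Fin.cons_snoc_eq_snoc_cons]
  congr 1
  funext i
  refine Fin.cases ?_ (fun i => ?_) i <;> simp

theorem endsWord_right (N : ℕ) (ℓ a : ℤ) :
    endsWord N ℓ a ℓ = Fin.cons a (fun _ : Fin (N + 1) => ℓ) := by
  rw [endsWord]
  congr 1
  funext i
  refine Fin.lastCases ?_ (fun i => ?_) i <;> simp

/-- This vanishes because of the last entry `ℓ + d` and the entry `ℓ` which stands `d` positions
before it. -/
theorem HallLittlewoodRelation.raisedWord_endsWord_of_right (hB : HallLittlewoodRelation B t)
    (N : ℕ) (ℓ a : ℤ) (d : ℕ) (h0 : 1 ≤ d) (hd : d ≤ N) :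
    raisedWord B t (endsWord N ℓ a (ℓ + d)) = 0 := by
  refine hB.raisedWord_eq_zero (d - 1) (⟨N - d, by omega⟩ : Fin N).castSucc.succ (Fin.last _)
    (by simp; omega) _ ?_
  have h1 : endsWord N ℓ a (ℓ + d) (Fin.last (N + 1)) = ℓ + d := by
    rw [endsWord, ← Fin.succ_last, Fin.cons_succ, Fin.snoc_last]
  rw [h1, endsWord, Fin.cons_succ, Fin.snoc_castSucc]
  omega

/-- This vanishes because of the first entry `ℓ - d` and the entry `ℓ` which stands `d` positions
after it. -/
theorem HallLittlewoodRelation.raisedWord_endsWord_of_left (hB : HallLittlewoodRelation B t)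
    (N : ℕ) (ℓ b : ℤ) (d : ℕ) (h0 : 1 ≤ d) (hd : d ≤ N) :
    raisedWord B t (endsWord N ℓ (ℓ - d) b) = 0 := by
  refine hB.raisedWord_eq_zero (d - 1) 0 (⟨d - 1, by omega⟩ : Fin N).castSucc.succ
    (by simp) _ ?_
  rw [endsWord, Fin.cons_succ, Fin.snoc_castSucc, Fin.cons_zero]
  omega

/-- The rectangle operator `B_{(ℓ, …, ℓ)}` with `N + 1` entries commutes up to the scalar `t ^ d`
with `B_{ℓ + d}` for `0 ≤ d ≤ N`. -/
theorem HallLittlewoodRelation.rect_mul (hB : HallLittlewoodRelation B t) (N : ℕ) (ℓ : ℤ)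
    (d : ℕ) (hd : d ≤ N) :
    raisedWord B t (fun _ : Fin (N + 1) => ℓ) * B (ℓ + d) =
      t ^ d • (B (ℓ + d) * raisedWord B t (fun _ : Fin (N + 1) => ℓ)) := by
  -- Each of the `d` steps from `(ℓ, …, ℓ, ℓ + d)` to `(ℓ + d, ℓ, …, ℓ)` costs a factor `t`.
  have key : ∀ m ≤ d, raisedWordOpen B t (endsWord N ℓ ℓ (ℓ + d)) =
      t ^ m • raisedWordOpen B t (endsWord N ℓ (ℓ + m) (ℓ + (d - m : ℕ))) := by
    intro m
    induction m with
    | zero => simp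
    | succ m ih =>
      intro hm
      rw [ih (by omega), raisedWordOpen_endsWord_of_eq_zero _ _ _ _ _ _
        (hB.raisedWord_endsWord_of_right N ℓ _ (d - m) (by omega) (by omega)), smul_smul, pow_succ]
      congr 3 <;> push_cast [Nat.cast_sub (show m + 1 ≤ d by omega),
        Nat.cast_sub (show m ≤ d by omega)] <;> ring
  rw [← hB.raisedWordOpen_snoc, ← hB.raisedWordOpen_cons, ← endsWord_left, ← endsWord_right,
    key d le_rfl]
  simp

/-- The rectangle operator `B_{(ℓ, …, ℓ)}` with `N + 1` entries commutes up to the scalar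
`t ^ (-d)` with `B_{ℓ - d}` for `0 ≤ d ≤ N`. -/
theorem HallLittlewoodRelation.mul_rect (hB : HallLittlewoodRelation B t) (N : ℕ) (ℓ : ℤ)
    (d : ℕ) (hd : d ≤ N) :
    B (ℓ - d) * raisedWord B t (fun _ : Fin (N + 1) => ℓ) =
      t ^ d • (raisedWord B t (fun _ : Fin (N + 1) => ℓ) * B (ℓ - d)) := by
  -- Each of the `d` steps from `(ℓ - d, ℓ, …, ℓ)` to `(ℓ, …, ℓ, ℓ - d)` costs a factor `t`.
  have key : ∀ m ≤ d, raisedWordOpen B t (endsWord N ℓ (ℓ - d) ℓ) =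
      t ^ m • raisedWordOpen B t (endsWord N ℓ (ℓ - (d - m : ℕ)) (ℓ - m)) := by
    intro m
    induction m with
    | zero => simp
    | succ m ih =>
      intro hm
      rw [ih (by omega), raisedWordOpen_endsWord_of_eq_zero _ _ _ _ _ _
        (hB.raisedWord_endsWord_of_left N ℓ _ (d - m) (by omega) (by omega)), smul_smul, pow_succ]
      congr 3 <;> push_cast [Nat.cast_sub (show m + 1 ≤ d by omega),
        Nat.cast_sub (show m ≤ d by omega)] <;> ring
  rw [← hB.raisedWordOpen_snoc, ← hB.raisedWordOpen_cons, ← endsWord_left, ← endsWord_right,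
    key d le_rfl]
  simp

end Rectangles

/-! ### Rectangles and raised words -/

section RectangleWords

variable {K E : Type*} [Field K] [Ring E] [Algebra K E]

/-- A linear map that vanishes on all index vectors which a product of raising factors can produce
from `v` vanishes on that product applied to `v`. -/
theorem map_prod_raisingFactor_mul_single_eq_zero {M : Type*} [AddCommGroup M] [Module K M]
    (t : K) {L : ℕ} (T : AddMonoidAlgebra K (Fin L → ℤ) →ₗ[K] M) (S : Finset (Fin L × Fin L))
    (v : Fin L → ℤ)
    (hT : ∀ w : Fin L → ℤ, ∑ i, w i = ∑ i, v i →
      (∀ i, w i ≤ v i + (S.filter fun p => p.1 = i).card) →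
      (∀ i, v i ≤ w i + (S.filter fun p => p.2 = i).card) → T (.single w 1) = 0) :
    T ((∏ p ∈ S, raisingFactor t p.1 p.2) * .single v 1) = 0 := by
  induction S using Finset.induction_on generalizing v with
  | empty => simpa using hT v rfl (by simp) (by simp)
  | insert p S hp ih =>
    rw [Finset.prod_insert hp, mul_comm (raisingFactor _ _ _), mul_assoc, raisingFactor_mul_single,
      mul_sub, mul_smul_comm, map_sub, map_smul, ih, ih, smul_zero, sub_zero]
    · intro w h1 h2 h3
      refine hT w ?_ (fun i => ?_) (fun i => ?_)
      · rw [h1]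
        simp [Finset.sum_add_distrib]
      · refine (h2 i).trans ?_
        rw [Finset.filter_insert]
        simp only [Pi.add_apply, Pi.sub_apply, Pi.single_apply, eq_comm (a := i)]
        split_ifs <;> simp [hp] <;> omega
      · have := h3 i
        rw [Finset.filter_insert]
        simp only [Pi.add_apply, Pi.sub_apply, Pi.single_apply, eq_comm (a := i)] at this
        split_ifs at this ⊢ <;> simp [hp] <;> omega
    · intro w h1 h2 h3
      refine hT w h1 (fun i => (h2 i).trans ?_) (fun i => (h3 i).trans ?_)
      all_goals
        gcongr
        exact Finset.subset_insert _ _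

theorem mul_wordProd_of_commute_up_to_scalar {B : ℤ → E} (A : E) {L : ℕ} (w : Fin L → ℤ)
    (c : Fin L → K) (h : ∀ i, A * B (w i) = c i • (B (w i) * A)) :
    A * wordProd B w = (∏ i, c i) • (wordProd B w * A) := by
  induction L with
  | zero => simp [wordProd]
  | succ L ih =>
    rw [← Fin.cons_self_tail w, wordProd_cons, Fin.prod_univ_succ, ← mul_assoc, h 0,
      smul_mul_assoc, mul_assoc, ih (Fin.tail w) (Fin.tail c) fun i => h i.succ, mul_smul_comm,
      smul_smul, mul_assoc]
    rfl

theorem raising_zero (K : Type*) [Field K] (L : ℕ) : raising (0 : K) L = 1 := by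
  simp [raising]

variable [CharZero K] {B : ℤ → E} {t : K}

theorem HallLittlewoodRelation.rect_mul_zpow (hB : HallLittlewoodRelation B t) (ht : t ≠ 0)
    (N : ℕ) (ℓ i : ℤ) (h1 : ℓ - N ≤ i) (h2 : i ≤ ℓ + N) :
    raisedWord B t (fun _ : Fin (N + 1) => ℓ) * B i =
      t ^ (i - ℓ) • (B i * raisedWord B t (fun _ : Fin (N + 1) => ℓ)) := by
  rcases le_total ℓ i with h | h
  · obtain ⟨d, rfl⟩ : ∃ d : ℕ, i = ℓ + d := ⟨(i - ℓ).toNat, by omega⟩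
    rw [hB.rect_mul N ℓ d (by omega), add_sub_cancel_left, zpow_natCast]
  · obtain ⟨d, rfl⟩ : ∃ d : ℕ, i = ℓ - d := ⟨(ℓ - i).toNat, by omega⟩
    rw [hB.mul_rect N ℓ d (by omega), smul_smul, show ℓ - d - ℓ = -(d : ℤ) by ring, zpow_neg,
      zpow_natCast, inv_mul_cancel₀ (pow_ne_zero _ ht), one_smul]

/-- The operator of a rectangle with `N + 1` rows of length `ℓ` commutes with `B_v` up to a power of
`t`, if the entries of `v` lie between `ℓ` and `ℓ + N - (L - 1)`: the raising operator changes an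
entry by at most `L - 1`, so that only operators `B_i` with `|i - ℓ| ≤ N` occur in `B_v`. -/
theorem HallLittlewoodRelation.rect_mul_raisedWord (hB : HallLittlewoodRelation B t)
    (N : ℕ) (ℓ : ℤ) {L : ℕ} (v : Fin L → ℤ) (h1 : ∀ i, ℓ ≤ v i) (h2 : ∀ i, v i + L ≤ ℓ + N + 1)
    (e : ℕ) (he : (e : ℤ) = ∑ i, (v i - ℓ)) :
    raisedWord B t (fun _ : Fin (N + 1) => ℓ) * raisedWord B t v =
      t ^ e • (raisedWord B t v * raisedWord B t (fun _ : Fin (N + 1) => ℓ)) := by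
  -- For `t = 0` the negative powers of `t` below make no sense, but then `B_v` is a single product.
  by_cases ht : t = 0
  · obtain ⟨d, rfl⟩ : ∃ d : Fin L → ℕ, v = fun i => ℓ + d i :=
      ⟨fun i => (v i - ℓ).toNat, funext fun i => by have := h1 i; simp only; omega⟩
    have hw : raisedWord B t (fun i => ℓ + d i) = wordProd B fun i => ℓ + d i := by
      rw [raisedWord, ht, raising_zero, one_mul, evalWords_single, one_smul]
    have he' : e = ∑ i, d i := by
      rw [← Nat.cast_inj (R := ℤ), he]
      push_cast
      exact Finset.sum_congr rfl fun i _ => by ring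
    rw [hw, he', ← Finset.prod_pow_eq_pow_sum]
    refine mul_wordProd_of_commute_up_to_scalar _ _ _ fun i => hB.rect_mul N ℓ (d i) ?_
    have h := h2 i
    have := i.pos
    simp only at h
    omega
  · set A := raisedWord B t (fun _ : Fin (N + 1) => ℓ) with hA
    -- The number of raising factors that raise, respectively lower, a given entry.
    have hcard1 : ∀ i : Fin L, (((Finset.univ.filter fun p : Fin L × Fin L => p.1 < p.2).filter
        fun p => p.1 = i).card : ℤ) ≤ L - 1 := fun i => by
      have : ((Finset.univ.filter fun p : Fin L × Fin L => p.1 < p.2).filter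
          fun p => p.1 = i).card ≤ (Finset.univ.erase i).card := by
        refine Finset.card_le_card_of_injOn Prod.snd ?_ ?_
        · rintro ⟨a, b⟩ h
          simp only [Finset.coe_filter, Finset.mem_filter, Set.mem_ofPred_eq, Finset.mem_univ,
            true_and] at h
          simpa [← h.2] using h.1.ne'
        · rintro ⟨a, b⟩ h ⟨a', b'⟩ h' hab
          simp only [Finset.coe_filter, Set.mem_ofPred_eq] at h h' hab
          rw [h.2, h'.2, hab]
      rw [Finset.card_erase_of_mem (Finset.mem_univ _), Finset.card_univ, Fintype.card_fin] at this
      have := i.pos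
      omega
    have hcard2 : ∀ i : Fin L, (((Finset.univ.filter fun p : Fin L × Fin L => p.1 < p.2).filter
        fun p => p.2 = i).card : ℤ) ≤ L - 1 := fun i => by
      have : ((Finset.univ.filter fun p : Fin L × Fin L => p.1 < p.2).filter
          fun p => p.2 = i).card ≤ (Finset.univ.erase i).card := by
        refine Finset.card_le_card_of_injOn Prod.fst ?_ ?_
        · rintro ⟨a, b⟩ h
          simp only [Finset.coe_filter, Finset.mem_filter, Set.mem_ofPred_eq, Finset.mem_univ,
            true_and] at h
          simpa [← h.2] using h.1.ne
        · rintro ⟨a, b⟩ h ⟨a', b'⟩ h' hab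
          simp only [Finset.coe_filter, Set.mem_ofPred_eq] at h h' hab
          rw [h.2, h'.2, hab]
      rw [Finset.card_erase_of_mem (Finset.mem_univ _), Finset.card_univ, Fintype.card_fin] at this
      have := i.pos
      omega
    have h := map_prod_raisingFactor_mul_single_eq_zero t
      ((LinearMap.mulLeft K A - t ^ e • LinearMap.mulRight K A) ∘ₗ evalWords K B L)
      (Finset.univ.filter fun p : Fin L × Fin L => p.1 < p.2) v ?_
    · exact sub_eq_zero.mp h
    · intro w hsum hup hdown
      rw [LinearMap.comp_apply, evalWords_single, one_smul, LinearMap.sub_apply,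
        LinearMap.smul_apply, LinearMap.mulLeft_apply, LinearMap.mulRight_apply, sub_eq_zero,
        mul_wordProd_of_commute_up_to_scalar A w (fun i => t ^ (w i - ℓ)) fun i => ?_]
      · rw [← zpow_natCast, he, Finset.sum_sub_distrib, ← hsum, ← Finset.sum_sub_distrib]
        congr 1
        induction (Finset.univ : Finset (Fin L)) using Finset.induction_on with
        | empty => simp
        | insert a s ha ih => rw [Finset.prod_insert ha, Finset.sum_insert ha, zpow_add₀ ht, ih]
      · have := hup i
        have := hdown i
        have := hcard1 i
        have := hcard2 i
        have := h1 i
        have := h2 i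
        exact hB.rect_mul_zpow ht N ℓ (w i) (by omega) (by omega)

end RectangleWords

/-! ### Power sums as derivations -/

section Derivations

variable {K : Type*} [Field K] [CharZero K]

theorem perp_add (f g : SymFun K) : perp (f + g) = perp f + perp g := by
  refine LinearMap.ext fun u => ext_hall fun w => ?_
  rw [LinearMap.add_apply, map_add, LinearMap.add_apply, hall_perp, hall_perp, hall_perp, add_mul,
    map_add]

theorem perp_smul (c : K) (f : SymFun K) : perp (c • f) = c • perp f := by
  refine LinearMap.ext fun u => ext_hall fun w => ?_
  rw [LinearMap.smul_apply, map_smul, LinearMap.smul_apply, hall_perp, hall_perp, smul_mul_assoc,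
    map_smul]

theorem perp_mul (f g : SymFun K) : perp (f * g) = perp f * perp g := by
  refine LinearMap.ext fun u => ext_hall fun w => ?_
  rw [Module.End.mul_apply, hall_perp, hall_perp, hall_perp, mul_comm f g, mul_assoc]

/-- The linear map `f ↦ f^⊥`. -/
noncomputable def perpLinear (K : Type*) [Field K] [CharZero K] :
    SymFun K →ₗ[K] Module.End K (SymFun K) where
  toFun := perp
  map_add' := perp_add
  map_smul' := perp_smul

theorem zee_add_single (a : ℕ+ →₀ ℕ) (n : ℕ+) :
    zee (a + Finsupp.single n 1) = n * (a n + 1) * zee a := by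
  classical
  have h : ∀ b : ℕ+ →₀ ℕ, zee b =
      ((n : ℕ) ^ b n * (b n).factorial) * (b.erase n).prod fun n m => (n : ℕ) ^ m * m.factorial :=
    fun b => by
      rw [zee]
      exact (Finsupp.mul_prod_erase' b n _ (by simp)).symm
  rw [h (a + _), h a, Finsupp.erase_add, Finsupp.erase_single, add_zero]
  simp only [Finsupp.add_apply, Finsupp.single_eq_same, Nat.factorial_succ]
  ring

/-- `pₙ^⊥` is the derivation `n ∂/∂pₙ`. -/
theorem perp_psum (n : ℕ+) (P : MvPolynomial ℕ+ K) :
    perp (psum K n) (powerSumEquiv K P) =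
      powerSumEquiv K (((n : ℕ) : K) • MvPolynomial.pderiv n P) := by
  classical
  have hb : ∀ a, powerSumEquiv K (MvPolynomial.monomial a 1) = powerSumBasis K a := fun a => by
    simp [powerSumBasis]
  refine LinearMap.congr_fun (f := perp (psum K n) ∘ₗ (powerSumEquiv K).toLinearMap)
    (g := (powerSumEquiv K).toLinearMap ∘ₗ (((n : ℕ) : K) •
      (MvPolynomial.pderiv n : Derivation K (MvPolynomial ℕ+ K) (MvPolynomial ℕ+ K)).toLinearMap))
    ((MvPolynomial.basisMonomials ℕ+ K).ext fun b => ext_hall fun u => ?_) P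
  refine LinearMap.congr_fun (f := (hall K _)) (g := (hall K _))
    ((powerSumBasis K).ext fun c => ?_) u
  have hn : psum K n = powerSumBasis K (Finsupp.single n 1) := by simp [powerSumBasis_apply]
  simp only [MvPolynomial.coe_basisMonomials, LinearMap.comp_apply, AlgEquiv.toLinearMap_apply,
    LinearMap.smul_apply, Derivation.coeFn_coe, MvPolynomial.pderiv_monomial, one_mul, hb,
    hall_perp]
  have h2 : MvPolynomial.monomial (b - Finsupp.single n 1) ((b n : ℕ) : K) =
      ((b n : ℕ) : K) • MvPolynomial.monomial (b - Finsupp.single n 1) 1 := by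
    rw [MvPolynomial.smul_monomial, smul_eq_mul, mul_one]
  simp only [h2, map_smul, hb, LinearMap.smul_apply, hn, ← powerSumBasis_add, hall_powerSumBasis]
  by_cases hbn : b n = 0
  · rw [if_neg, hbn]
    · simp
    · rintro rfl
      simp at hbn
  · obtain ⟨a, rfl⟩ : ∃ a, b = a + Finsupp.single n 1 :=
      ⟨b - Finsupp.single n 1, (tsub_add_cancel_of_le
        (Finsupp.single_le_iff.mpr (Nat.one_le_iff_ne_zero.mpr hbn))).symm⟩
    rw [add_tsub_cancel_right, add_comm (Finsupp.single n 1) c]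
    simp only [add_left_inj]
    split_ifs
    · rw [zee_add_single]
      simp
      ring
    · simp

theorem perp_psum_mul (n : ℕ+) (f g : SymFun K) :
    perp (psum K n) (f * g) = perp (psum K n) f * g + f * perp (psum K n) g := by
  obtain ⟨P, rfl⟩ := (powerSumEquiv K).surjective f
  obtain ⟨Q, rfl⟩ := (powerSumEquiv K).surjective g
  rw [← map_mul, perp_psum, perp_psum, perp_psum, MvPolynomial.pderiv_mul, smul_add, map_add,
    ← map_mul, ← map_mul, smul_mul_assoc, mul_smul_comm]

theorem perp_psum_psum (m n : ℕ+) :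
    perp (psum K m) (psum K n) = if m = n then algebraMap K (SymFun K) (n : ℕ) else 0 := by
  classical
  have h : ∀ n, powerSumEquiv K (MvPolynomial.X n) = psum K n := fun n => by
    simp [powerSumEquiv, ofPoly]
  rw [← h n, perp_psum, MvPolynomial.pderiv_X, Pi.single_apply]
  by_cases hmn : m = n
  · subst hmn
    rw [if_pos rfl, if_pos rfl, map_smul, map_one, Algebra.algebraMap_eq_smul_one]
  · rw [if_neg (Ne.symm hmn), if_neg hmn, smul_zero, map_zero]

omit [CharZero K] in
theorem hsymm_of_neg {r : ℤ} (hr : r < 0) : hsymm K r = 0 := by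
  refine Subtype.ext (MvPowerSeries.ext fun d => ?_)
  rw [coeff_hsymm, if_neg (by omega)]
  rfl

omit [CharZero K] in
theorem hsymm_zero : hsymm K 0 = 1 := by
  classical
  refine Subtype.ext (MvPowerSeries.ext fun d => ?_)
  rw [coeff_hsymm]
  change _ = MvPowerSeries.coeff d 1
  rw [MvPowerSeries.coeff_one]
  exact if_congr (by simp [Finsupp.degree_eq_zero_iff]) rfl rfl

omit [CharZero K] in
/-- Newton's identity `m h_m = ∑ₖ pₖ h_{m-k}`, with any number `N ≥ m` of terms. -/
theorem smul_hsymm (m : ℤ) (N : ℕ) (hN : m ≤ N) :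
    (m : K) • hsymm K m =
      ∑ k ∈ Finset.range N, psum K k.succPNat * hsymm K (m - (k + 1)) := by
  classical
  refine Subtype.ext (MvPowerSeries.ext fun d => ?_)
  rw [AddSubmonoidClass.coe_finsetSum, map_sum]
  -- For each variable `xⱼ` the `k` with `k + 1 ≤ dⱼ` contribute `1`, in total `∑ⱼ dⱼ = m`.
  have h1 : ∀ k : ℕ, MvPowerSeries.coeff d
      ((psum K k.succPNat * hsymm K (m - (k + 1)) : SymFun K) : MvPowerSeries ℕ K) =
        ∑ j ∈ d.support, if (d.degree : ℤ) = m ∧ k < d j then 1 else 0 := by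
    intro k
    rw [MulMemClass.coe_mul, mul_comm]
    refine (coeff_psumSeries_mul _ _ _).trans ?_
    rw [Finset.sum_filter]
    refine Finset.sum_congr rfl fun j hj => ?_
    by_cases hk : k < d j
    · have hle := tsub_add_cancel_of_le (Finsupp.single_le_iff.mpr (show k + 1 ≤ d j from hk))
      have hdeg := congrArg Finsupp.degree hle
      rw [map_add, Finsupp.degree_single] at hdeg
      rw [if_pos (by simpa using hk), coeff_hsymm, Nat.succPNat_coe]
      refine if_congr ?_ rfl rfl
      simp only [hk, and_true, Nat.succ_eq_add_one]
      omega
    · rw [if_neg (by simpa using hk), if_neg (fun h => hk h.2)]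
  simp_rw [h1]
  rw [Finset.sum_comm]
  have h2 : MvPowerSeries.coeff d (((m : K) • hsymm K m : SymFun K) : MvPowerSeries ℕ K) =
      (m : K) * if (d.degree : ℤ) = m then 1 else 0 := rfl
  rw [h2]
  by_cases hd : (d.degree : ℤ) = m
  · simp only [hd, true_and, if_true, mul_one]
    rw [← hd, Int.cast_natCast, Finsupp.degree_apply, Nat.cast_sum]
    refine Finset.sum_congr rfl fun j hj => ?_
    have hj : d j ≤ N := by
      have := Finsupp.le_degree j d
      omega
    rw [← Finset.sum_filter, Finset.sum_const, nsmul_one]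
    congr 1
    rw [show (Finset.range N).filter (fun k => k < d j) = Finset.range (d j) by
      ext k; simp; omega, Finset.card_range]
  · simp [hd]

/-- `pₙ^⊥ h_m = h_{m-n}`. -/
theorem perp_psum_hsymm (n : ℕ+) (m : ℤ) :
    perp (psum K n) (hsymm K m) = hsymm K (m - (n : ℕ)) := by
  have hn := n.pos
  have h0 : ∀ m : ℤ, m ≤ 0 → perp (psum K n) (hsymm K m) = hsymm K (m - (n : ℕ)) := by
    intro m hm
    rcases hm.lt_or_eq with hm | rfl
    · rw [hsymm_of_neg hm, map_zero, hsymm_of_neg (by omega)]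
    · have h2 : perp (psum K n) (powerSumEquiv K 1) = 0 := by
        rw [perp_psum, MvPolynomial.pderiv_one, smul_zero, map_zero]
      rw [hsymm_zero, hsymm_of_neg (by omega), ← map_one (powerSumEquiv K), h2]
  rcases le_or_gt m 0 with hm | hm
  · exact h0 m hm
  obtain ⟨M, rfl⟩ : ∃ M : ℕ, m = M := ⟨m.toNat, by omega⟩
  induction M using Nat.strong_induction_on with
  | _ M ih =>
    have ih' : ∀ m : ℤ, m < M → perp (psum K n) (hsymm K m) = hsymm K (m - (n : ℕ)) := by
      intro m hm
      rcases le_or_gt m 0 with hm' | hm'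
      · exact h0 m hm'
      · obtain ⟨M', rfl⟩ : ∃ M' : ℕ, m = M' := ⟨m.toNat, by omega⟩
        exact ih M' (by omega) hm'
    have hM : ((M : ℤ) : K) ≠ 0 := by
      rw [Int.cast_natCast, Nat.cast_ne_zero]
      omega
    refine smul_right_injective _ hM ?_
    simp only
    rw [← map_smul, smul_hsymm M (M + n) (by push_cast; omega), map_sum]
    have h3 : ∀ k ∈ Finset.range (M + n),
        perp (psum K n) (psum K k.succPNat * hsymm K (M - (k + 1))) =
          (if k = (n : ℕ) - 1 then ((n : ℕ) : K) • hsymm K (M - (n : ℕ)) else 0) +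
            psum K k.succPNat * hsymm K (M - (n : ℕ) - (k + 1)) := by
      intro k _
      rw [perp_psum_mul, ih' _ (by omega), perp_psum_psum, sub_right_comm]
      congr 1
      by_cases hk : n = k.succPNat
      · have hk' : k = (n : ℕ) - 1 := by rw [hk]; simp
        have hk2 : ((k : ℤ) + 1) = (n : ℕ) := by omega
        rw [if_pos hk, if_pos hk', ← hk, ← Algebra.smul_def, hk2]
      · have hk' : ¬ k = (n : ℕ) - 1 := fun h => hk (PNat.coe_inj.mp (by
          rw [Nat.succPNat_coe]; omega))
        rw [if_neg hk, if_neg hk', zero_mul]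
    rw [Finset.sum_congr rfl h3, Finset.sum_add_distrib, Finset.sum_ite_eq',
      if_pos (Finset.mem_range.mpr (by omega)),
      ← smul_hsymm (M - (n : ℕ)) (M + n) (by push_cast; omega), ← add_smul]
    congr 1
    push_cast
    ring

end Derivations

/-! ### The quadratic relation for the vertex operators -/

section VertexRelation

variable {K : Type*} [Field K] [CharZero K]

theorem perp_one : perp (1 : SymFun K) = 1 :=
  LinearMap.ext fun u => ext_hall fun w => by rw [hall_perp, one_mul, Module.End.one_apply]

/-- The annihilation part `h_i[X(t-1)]^⊥` of the vertex operators. -/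
noncomputable def plethPerp (t : K) (i : ℤ) : Module.End K (SymFun K) :=
  perp (pleth t (hsymm K i))

theorem plethPerp_of_neg (t : K) {i : ℤ} (hi : i < 0) : plethPerp t i = 0 := by
  rw [plethPerp, hsymm_of_neg hi, map_zero]
  exact map_zero (perpLinear K)

theorem plethPerp_zero (t : K) : plethPerp t 0 = 1 := by
  rw [plethPerp, hsymm_zero, map_one, perp_one]

/-- Newton's identity for the annihilation part. -/
theorem smul_plethPerp (t : K) (i : ℤ) (N : ℕ) (hN : i ≤ N) (g : SymFun K) :
    (i : K) • plethPerp t i g = ∑ k ∈ Finset.range N,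
      (t ^ (k + 1) - 1) • perp (psum K k.succPNat) (plethPerp t (i - (k + 1)) g) := by
  have h := congrArg (fun f => perpLinear K (pleth t f) g) (smul_hsymm (K := K) i N hN)
  simp only [map_smul, map_sum, map_mul, pleth_psum, smul_mul_assoc, LinearMap.smul_apply,
    LinearMap.sum_apply] at h
  refine h.trans (Finset.sum_congr rfl fun k _ => ?_)
  rw [Nat.succPNat_coe]
  exact congrArg _ (LinearMap.congr_fun (perp_mul _ _) g)

theorem perp_psum_hsymm_mul (k : ℕ) (m : ℤ) (g : SymFun K) :
    perp (psum K k.succPNat) (hsymm K m * g) =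
      hsymm K (m - (k + 1)) * g + hsymm K m * perp (psum K k.succPNat) g := by
  rw [perp_psum_mul, perp_psum_hsymm, Nat.succPNat_coe]
  push_cast
  rfl

/-- The commutation relation of the annihilation and the creation part, in generating functions
`(1 - t w/z) Q(z) H(w) = (1 - w/z) H(w) Q(z)`. Both sides satisfy the recursion in `i` that
comes from Newton's identity. -/
theorem plethPerp_hsymm_mul (t : K) (i m : ℤ) (g : SymFun K) :
    plethPerp t i (hsymm K m * g) - t • plethPerp t (i - 1) (hsymm K (m - 1) * g) =
      hsymm K m * plethPerp t i g - hsymm K (m - 1) * plethPerp t (i - 1) g := by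
  rcases lt_trichotomy i 0 with hi | rfl | hi
  · simp [plethPerp_of_neg t hi, plethPerp_of_neg t (show i - 1 < 0 by omega)]
  · simp [plethPerp_zero, plethPerp_of_neg t (show (-1 : ℤ) < 0 by omega)]
  obtain ⟨M, rfl⟩ : ∃ M : ℕ, i = M := ⟨i.toNat, by omega⟩
  induction M using Nat.strong_induction_on generalizing m with
  | _ M ih =>
    have ih' : ∀ (k : ℕ) (m : ℤ), plethPerp t (M - (k + 1)) (hsymm K m * g) -
        t • plethPerp t (M - (k + 1) - 1) (hsymm K (m - 1) * g) =
          hsymm K m * plethPerp t (M - (k + 1)) g -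
            hsymm K (m - 1) * plethPerp t (M - (k + 1) - 1) g := by
      intro k m
      rcases lt_trichotomy ((M : ℤ) - (k + 1)) 0 with h | h | h
      · simp [plethPerp_of_neg t h, plethPerp_of_neg t (show (M : ℤ) - (k + 1) - 1 < 0 by omega)]
      · simp [h, plethPerp_zero, plethPerp_of_neg t (show (-1 : ℤ) < 0 by omega)]
      · have h2 : (M : ℤ) - (k + 1) = (M - (k + 1) : ℕ) := by omega
        rw [h2] at h ⊢
        exact ih _ (by omega) m h
    have hM : ((M : ℤ) : K) ≠ 0 := by
      rw [Int.cast_natCast, Nat.cast_ne_zero]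
      omega
    have hcomm : ∀ k : ℕ, (M : ℤ) - (k + 1) - 1 = M - 1 - (k + 1) := fun k => by ring
    -- Newton's identity for all four terms, the relation being known for smaller `i`.
    have hL := smul_plethPerp t M M le_rfl (hsymm K m * g)
    have hL' := smul_plethPerp t (M - 1) M (by omega) (hsymm K (m - 1) * g)
    have hR := smul_plethPerp t M M le_rfl g
    have hR' := smul_plethPerp t (M - 1) M (by omega) g
    have hsum : ((M : ℤ) : K) • plethPerp t M (hsymm K m * g) -
        t • (((M - 1 : ℤ) : ℤ) : K) • plethPerp t (M - 1) (hsymm K (m - 1) * g) =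
        hsymm K m * (((M : ℤ) : K) • plethPerp t M g) -
          hsymm K (m - 1) * ((((M - 1 : ℤ) : ℤ) : K) • plethPerp t (M - 1) g) +
        ∑ k ∈ Finset.range M, (t ^ (k + 1) - 1) •
          (hsymm K (m - (k + 1)) * plethPerp t (M - (k + 1)) g -
            hsymm K (m - (k + 1) - 1) * plethPerp t (M - (k + 1) - 1) g) := by
      rw [hL, hL', hR, hR', Finset.smul_sum, Finset.mul_sum, Finset.mul_sum,
        ← Finset.sum_sub_distrib, ← Finset.sum_sub_distrib, ← Finset.sum_add_distrib]
      refine Finset.sum_congr rfl fun k _ => ?_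
      have h := congrArg (perp (psum K k.succPNat)) (ih' k m)
      rw [map_sub, map_sub, map_smul, perp_psum_hsymm_mul, perp_psum_hsymm_mul] at h
      rw [smul_comm t, ← smul_sub, ← hcomm, h, mul_smul_comm, mul_smul_comm, ← smul_sub,
        ← smul_add, sub_right_comm m 1]
      congr 1
      abel
    -- The sum that remains, with factors `t ^ (k + 1) - 1`, is a difference of two telescoping sums;
    -- the first of them telescopes after applying the relation again.
    have htel1 : ∑ k ∈ Finset.range M, t ^ (k + 1) •
        (hsymm K (m - (k + 1)) * plethPerp t (M - (k + 1)) g -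
          hsymm K (m - (k + 1) - 1) * plethPerp t (M - (k + 1) - 1) g) =
        t • plethPerp t (M - 1) (hsymm K (m - 1) * g) := by
      have := Finset.sum_range_sub' (fun k : ℕ => t ^ (k + 1) •
        plethPerp t (M - (k + 1)) (hsymm K (m - (k + 1)) * g)) M
      rw [plethPerp_of_neg t (show (M : ℤ) - (M + 1) < 0 by omega)] at this
      simp only [LinearMap.zero_apply, smul_zero, sub_zero, Nat.cast_zero, zero_add,
        pow_one] at this
      rw [← this]
      refine Finset.sum_congr rfl fun k _ => ?_
      rw [← ih', smul_sub, smul_smul, ← pow_succ]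
      push_cast
      congr 4 <;> ring_nf
    have htel2 : ∑ k ∈ Finset.range M,
        (hsymm K (m - (k + 1)) * plethPerp t (M - (k + 1)) g -
          hsymm K (m - (k + 1) - 1) * plethPerp t (M - (k + 1) - 1) g) =
        hsymm K (m - 1) * plethPerp t (M - 1) g := by
      have := Finset.sum_range_sub' (fun k : ℕ =>
        hsymm K (m - (k + 1)) * plethPerp t (M - (k + 1)) g) M
      rw [plethPerp_of_neg t (show (M : ℤ) - (M + 1) < 0 by omega)] at this
      simp only [LinearMap.zero_apply, mul_zero, sub_zero, Nat.cast_zero, zero_add] at this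
      rw [← this]
      refine Finset.sum_congr rfl fun k _ => ?_
      push_cast
      congr 3 <;> ring_nf
    refine smul_right_injective _ hM ?_
    simp only [sub_smul, one_smul, Finset.sum_sub_distrib] at hsum
    simp only [← Finset.sum_sub_distrib, htel1, htel2] at hsum
    push_cast at hsum ⊢
    simp only [sub_smul, one_smul, smul_sub, mul_sub, mul_smul_comm] at hsum ⊢
    rw [smul_comm (M : K) t]
    rw [← sub_eq_zero] at hsum ⊢
    rw [← hsum]
    abel

theorem eventually_plethPerp_eq_zero (t : K) (g : SymFun K) :
    ∀ᶠ M : ℕ in Filter.atTop, ∀ i : ℕ, M ≤ i → plethPerp t i g = 0 := by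
  have hg : g ∈ Submodule.span K (Set.range (powerSumBasis K)) := (powerSumBasis K).mem_span g
  induction hg using Submodule.span_induction with
  | zero => simp
  | mem x hx =>
    obtain ⟨b, rfl⟩ := hx
    filter_upwards [Filter.eventually_gt_atTop (wt b)] with M hM i hi
    refine exists_perp_eq_zero b _ fun a ha => ?_
    rw [repr_pleth, repr_hsymm_eq_zero, mul_zero]
    have h1 : wt a ≤ wt b := by
      rw [← tsub_add_cancel_of_le ha, map_add]
      exact Nat.le_add_left _ _
    omega
  | add g g' _ _ h h' =>
    filter_upwards [h, h'] with M hM hM' i hi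
    rw [map_add, hM i hi, hM' i hi, add_zero]
  | smul c g _ h =>
    filter_upwards [h] with M hM i hi
    rw [map_smul, hM i hi, smul_zero]

theorem vertexOp_eq_sum (t : K) (ℓ : ℤ) (g : SymFun K) (M : ℕ)
    (hM : ∀ i : ℕ, M ≤ i → plethPerp t i g = 0) :
    vertexOp t ℓ g = ∑ i ∈ Finset.range M, hsymm K (i + ℓ) * plethPerp t i g := by
  refine finsum_eq_sum_of_support_subset _ fun i hi => ?_
  by_contra h
  refine hi ?_
  have := hM i (by simpa using h)
  rw [plethPerp] at this
  simp [this]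

theorem eventually_vertexOp_vertexOp (t : K) (a b : ℤ) (g : SymFun K) :
    ∀ᶠ M : ℕ in Filter.atTop, ∀ M' N' : ℕ, M ≤ M' → M ≤ N' →
      vertexOp t a (vertexOp t b g) = ∑ i ∈ Finset.range M', ∑ j ∈ Finset.range N',
        hsymm K (i + a) * plethPerp t i (hsymm K (j + b) * plethPerp t j g) := by
  filter_upwards [eventually_plethPerp_eq_zero t g,
    eventually_plethPerp_eq_zero t (vertexOp t b g)] with M h1 h2 M' N' hM' hN'
  rw [vertexOp_eq_sum t a _ M' fun i hi => h2 i (hM'.trans hi),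
    vertexOp_eq_sum t b g N' fun i hi => h1 i (hN'.trans hi)]
  simp only [map_sum, Finset.mul_sum]

/-- The vertex operators satisfy the Hall-Littlewood relation: moving the annihilation part of the
left factor to the right turns `B_a B_b - t B_{a+1} B_{b-1}` into `N_{a,b} - N_{a+1,b-1}` for the
normally ordered products `N_{a,b} = ∑ h_{i+a} h_{j+b} Q_i Q_j`, which are symmetric. -/
theorem vertexOp_relation (t : K) : HallLittlewoodRelation (vertexOp t) t := by
  suffices H : ∀ (a b : ℤ) (g : SymFun K), ∀ᶠ M : ℕ in Filter.atTop,
      vertexOp t a (vertexOp t b g) - t • vertexOp t (a + 1) (vertexOp t (b - 1) g) =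
        ∑ i ∈ Finset.range (M + 1), ∑ j ∈ Finset.range (M + 1),
          (hsymm K (i + a) * hsymm K (j + b) * plethPerp t i (plethPerp t j g) -
            hsymm K (i + (a + 1)) * hsymm K (j + (b - 1)) *
              plethPerp t i (plethPerp t j g)) by
    intro a b
    refine LinearMap.ext fun g => ?_
    obtain ⟨M, h1, h2⟩ := ((H a b g).and (H (b - 1) (a + 1) g)).exists
    simp only [sub_add_cancel, add_sub_cancel_right] at h2
    simp only [LinearMap.sub_apply, LinearMap.neg_apply, LinearMap.smul_apply,
      Module.End.mul_apply]
    rw [h1, h2, Finset.sum_comm, ← Finset.sum_neg_distrib]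
    refine Finset.sum_congr rfl fun i _ => ?_
    rw [← Finset.sum_neg_distrib]
    refine Finset.sum_congr rfl fun j _ => ?_
    have hcomm : plethPerp t j (plethPerp t i g) = plethPerp t i (plethPerp t j g) := by
      rw [← Module.End.mul_apply, ← Module.End.mul_apply, plethPerp, plethPerp, ← perp_mul,
        ← perp_mul, mul_comm]
    rw [hcomm]
    ring
  intro a b g
  have hfin : ∀ᶠ M : ℕ in Filter.atTop, ∀ i : ℕ, M ≤ i → ∀ j : ℕ,
      plethPerp t i (plethPerp t j g) = 0 := by
    filter_upwards [eventually_plethPerp_eq_zero t g] with M hM i hi j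
    rw [← Module.End.mul_apply, plethPerp, plethPerp, ← perp_mul, mul_comm, perp_mul,
      Module.End.mul_apply]
    have := hM i hi
    rw [plethPerp] at this
    rw [this, map_zero]
  -- The index shift `i ↦ i - 1` brings `B_{a+1}` to the creation part `h_{i+a}` of `B_a`.
  have hshift : ∀ (f : ℤ → SymFun K) (M : ℕ), f (-1) = 0 →
      ∑ i ∈ Finset.range M, f i = ∑ i ∈ Finset.range (M + 1), f (i - 1) := by
    intro f M hf
    rw [Finset.sum_range_succ']
    simp [hf]
  filter_upwards [eventually_vertexOp_vertexOp t a b g,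
    eventually_vertexOp_vertexOp t (a + 1) (b - 1) g, hfin] with M h1 h2 h3
  have hidx : ∀ i : ℕ, (i : ℤ) - 1 + (a + 1) = i + a := fun i => by ring
  have hneg : plethPerp t (-1) = 0 := plethPerp_of_neg t (by omega)
  rw [h1 (M + 1) (M + 1) (by omega) (by omega), h2 M (M + 1) le_rfl (by omega),
    hshift (fun i => ∑ j ∈ Finset.range (M + 1), hsymm K (i + (a + 1)) *
      plethPerp t i (hsymm K (j + (b - 1)) * plethPerp t j g)) M (by simp [hneg])]
  have h4 : ∑ i ∈ Finset.range (M + 1), ∑ j ∈ Finset.range (M + 1),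
      hsymm K (i + (a + 1)) * hsymm K (j + (b - 1)) * plethPerp t i (plethPerp t j g) =
      ∑ i ∈ Finset.range (M + 1), ∑ j ∈ Finset.range (M + 1),
        hsymm K (i + a) * hsymm K (j + (b - 1)) * plethPerp t (i - 1) (plethPerp t j g) := by
    rw [Finset.sum_range_succ]
    simp only [h3 M le_rfl, mul_zero, Finset.sum_const_zero, add_zero]
    rw [hshift (fun i => ∑ j ∈ Finset.range (M + 1), hsymm K (i + (a + 1)) *
      hsymm K (j + (b - 1)) * plethPerp t i (plethPerp t j g)) M (by simp [hneg])]
    simp only [hidx]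
  simp only [Finset.sum_sub_distrib, h4, Finset.smul_sum]
  simp only [← Finset.sum_sub_distrib, hidx]
  refine Finset.sum_congr rfl fun i _ => Finset.sum_congr rfl fun j _ => ?_
  have key := plethPerp_hsymm_mul t i (j + b) (plethPerp t j g)
  rw [add_sub_assoc] at key
  rw [← mul_smul_comm, ← mul_sub, key, mul_sub, mul_assoc, mul_assoc]

end VertexRelation

/-! ### The commutation theorem -/

theorem vertexVec_eq_raisedWord {K : Type*} [Field K] [CharZero K] (t : K) {L : ℕ}
    (v : Fin L → ℤ) : vertexVec t v = raisedWord (vertexOp t) t v := by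
  simp [vertexVec, raisedWord, evalWords, wordProd]
  rfl

end SymFun

theorem YoungDiagram.sum_rowLen (lam : YoungDiagram) :
    ∑ i : Fin (lam.colLen 0), lam.rowLen i = lam.card := by
  rw [Fin.sum_univ_eq_sum_range, YoungDiagram.card, Finset.card_eq_sum_card_fiberwise
    (f := Prod.fst) (t := Finset.range (lam.colLen 0))]
  · exact Finset.sum_congr rfl fun i _ => lam.rowLen_eq_card
  · rintro ⟨i, j⟩ h
    simp only [Finset.coe_range, Set.mem_Iio]
    exact YoungDiagram.mem_iff_lt_colLen.mp (lam.up_left_mem le_rfl (Nat.zero_le j)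
      (YoungDiagram.mem_cells _ |>.mp h))

theorem mainTheorem3 (K : Type*) [Field K] [CharZero K] (t : K) :
    (∀ k ℓ i : ℕ, ℓ ≤ i → i ≤ k →
      SymFun.vertexRect t k ℓ * SymFun.vertexOp t i =
        t ^ (i - ℓ) • (SymFun.vertexOp t i * SymFun.vertexRect t k ℓ)) ∧
    (∀ (k ℓ : ℕ) (ν : YoungDiagram), (0, 0) ∈ ν → ν.hookLen (0, 0) = k →
      ℓ ≤ ν.rowLen (ν.colLen 0 - 1) →
      SymFun.vertexRect t k ℓ * SymFun.vertexPartition t ν =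
        t ^ (ν.card - ν.colLen 0 * ℓ) •
          (SymFun.vertexPartition t ν * SymFun.vertexRect t k ℓ)) := by
  have hB := SymFun.vertexOp_relation t
  have hrect : ∀ N k ℓ : ℕ, k = ℓ + N → SymFun.vertexRect t k ℓ =
      SymFun.raisedWord (SymFun.vertexOp t) t (fun _ : Fin (N + 1) => (ℓ : ℤ)) := by
    rintro N k ℓ rfl
    rw [SymFun.vertexRect, SymFun.vertexVec_eq_raisedWord, show ℓ + N + 1 - ℓ = N + 1 by omega]
  refine ⟨fun k ℓ i hℓ hi => ?_, fun k ℓ ν h0 hk hℓ => ?_⟩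
  · obtain ⟨d, rfl⟩ := Nat.exists_eq_add_of_le hℓ
    obtain ⟨N, rfl⟩ := Nat.exists_eq_add_of_le (hℓ.trans hi)
    rw [hrect N _ ℓ rfl, Nat.add_sub_cancel_left, Nat.cast_add]
    exact hB.rect_mul N ℓ d (by omega)
  · have hcol : 0 < ν.colLen 0 := YoungDiagram.mem_iff_lt_colLen.mp h0
    have hrow : 0 < ν.rowLen 0 := YoungDiagram.mem_iff_lt_rowLen.mp h0
    have hk' : k + 1 = ν.rowLen 0 + ν.colLen 0 := by
      rw [← hk, YoungDiagram.hookLen]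
      simp only
      omega
    have hge : ∀ i : Fin (ν.colLen 0), ℓ ≤ ν.rowLen i := fun i =>
      hℓ.trans (ν.rowLen_anti _ _ (by omega))
    have hle : ∀ i, ν.rowLen i ≤ ν.rowLen 0 := fun i => ν.rowLen_anti _ _ (Nat.zero_le i)
    have hℓ0 : ℓ ≤ ν.rowLen 0 := hℓ.trans (hle _)
    obtain ⟨N, rfl⟩ := Nat.exists_eq_add_of_le (show ℓ ≤ k by omega)
    rw [hrect N _ ℓ rfl, SymFun.vertexPartition, SymFun.vertexVec_eq_raisedWord]
    refine hB.rect_mul_raisedWord N ℓ _ (fun i => by exact_mod_cast hge i) (fun i => ?_) _ ?_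
    · have := hle i
      omega
    · have hsum : ν.colLen 0 * ℓ ≤ ν.card := by
        rw [← ν.sum_rowLen]
        simpa using Finset.sum_le_sum fun (i : Fin (ν.colLen 0)) (_ : i ∈ Finset.univ) => hge i
      rw [Nat.cast_sub hsum, ← ν.sum_rowLen, Finset.sum_sub_distrib]
      simp
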